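/- Let $(M^n,g)$ be a closed, connected smooth Riemannian manifold of dimension $n\ge 6$, and let $\mathcal J_g(M)$ be the set of smooth almost complex structures $J$ on $M$ compatible with $g$, i.e. $J^2=-\mathrm{id}$ and $g(JX,JY)=g(X,Y)$. Equip $\mathcal J_g(M)$ with the $C^0$ topology, i.e. the topology of the distance $\sup_{x\in M}|J_0-J|_g(x)$. Let $\nabla$ be the Levi-Civita connection of $g$, let $R(X,Y)Z=\nabla_{[X,Y]}Z-[\nabla_X,\nabla_Y]Z$, and put $$\operatorname{Ric}(X,Y)=\operatorname{tr}\{Z\mapsto R(X,Z)Y\},\qquad \operatorname{Ric}^*(X,Y)=\operatorname{tr}\{Z\mapsto -J(R(X,Z)(JY))\}.$$ For $J\in\mathcal J_g(M)$ let $S_J=\operatorname{tr}_g\operatorname{Ric}-\operatorname{tr}_g\operatorname{Ric}^*$ be the holomorphic d-scalar curvature, and with $p=\frac{2n}{n-2}$ define $$Q_{g,J}(u)=\frac{\int_M \left(4|du|_g^2+S_Ju^2\right)dV_g}{\left(\int_M|u|^p\,dV_g\right)^{2/p}},\qquad Y(M,g,J)=\inf\{Q_{g,J}(u):u\in C^\infty(M),\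 u>0\}.$$ Then $Y(M,g,J)$ is a real number (the infimum is finite) for every $J\in\mathcal J_g(M)$, and the functional $$Y(M,g,\cdot):\mathcal J_g(M)\to\mathbb R,\qquad J\mapsto Y(M,g,J)$$ is continuous. -/

import Mathlib

open Bundle Manifold MeasureTheory
open scoped ContDiff Topology

noncomputable section

namespace HolomorphicYamabe

/- Throughout, a Riemannian manifold of dimension `n` is a smooth manifold `M` modelled on
`EuclideanSpace ℝ (Fin n)` (no boundary) with a smooth inner product on the tangent bundle
(`RiemannianBundle` gives the inner products, `IsContMDiffRiemannianBundle` their smoothness). -/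
variable {n : ℕ} {M : Type*} [TopologicalSpace M] [ChartedSpace (EuclideanSpace ℝ (Fin n)) M]
  [IsManifold (𝓡 n) ∞ M]

instance finiteDimensional_tangentSpace (x : M) : FiniteDimensional ℝ (TangentSpace (𝓡 n) x) :=
  inferInstanceAs (FiniteDimensional ℝ (EuclideanSpace ℝ (Fin n)))

variable (n M) in
/-- A smooth partition of unity subordinate to the coordinate charts. -/
def chartPartition [T2Space M] [SigmaCompactSpace M] : SmoothPartitionOfUnity M (𝓡 n) M Set.univ :=
  (SmoothPartitionOfUnity.exists_isSubordinate_chartAt_source (𝓡 n) M).choose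

theorem chartPartition_isSubordinate [T2Space M] [SigmaCompactSpace M] :
    (chartPartition n M).IsSubordinate
      (fun x ↦ (chartAt (EuclideanSpace ℝ (Fin n)) x).source) :=
  (SmoothPartitionOfUnity.exists_isSubordinate_chartAt_source (𝓡 n) M).choose_spec

section Metric

variable [RiemannianBundle (fun x : M ↦ TangentSpace (𝓡 n) x)]

/-- The chosen `g`-orthonormal basis of `T_x M`, used only to take metric traces. -/
def onb (x : M) : OrthonormalBasis (Fin (Module.finrank ℝ (TangentSpace (𝓡 n) x))) ℝ
    (TangentSpace (𝓡 n) x) :=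
  stdOrthonormalBasis ℝ (TangentSpace (𝓡 n) x)

/-- The right-hand side of the Koszul formula for `g(∇_X Y, Z)` at `x`. -/
def koszul (X Y Z : Π x : M, TangentSpace (𝓡 n) x) (x : M) : ℝ :=
  (mvfderiv (𝓡 n) (fun y ↦ (inner ℝ (Y y) (Z y) : ℝ)) x (X x)
    + mvfderiv (𝓡 n) (fun y ↦ (inner ℝ (X y) (Z y) : ℝ)) x (Y x)
    - mvfderiv (𝓡 n) (fun y ↦ (inner ℝ (X y) (Y y) : ℝ)) x (Z x)
    + inner ℝ (VectorField.mlieBracket (𝓡 n) X Y x) (Z x)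
    - inner ℝ (VectorField.mlieBracket (𝓡 n) X Z x) (Y x)
    - inner ℝ (VectorField.mlieBracket (𝓡 n) Y Z x) (X x)) / 2

/-- The Levi-Civita connection `∇_X Y` of smooth vector fields: the vector whose inner product with
each `e i` is given by the Koszul formula. `FiberBundle.extend` extends a tangent vector at `x` to
a vector field that is smooth near `x`. -/
def leviCivita (X Y : Π x : M, TangentSpace (𝓡 n) x) (x : M) : TangentSpace (𝓡 n) x :=
  ∑ i, koszul X Y (FiberBundle.extend (EuclideanSpace ℝ (Fin n)) (onb x i)) x • onb x i

/-- `R(X, Y)Z = ∇_[X, Y] Z - [∇_X, ∇_Y] Z` for vector fields. -/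
def curvatureField (X Y Z : Π x : M, TangentSpace (𝓡 n) x) (x : M) : TangentSpace (𝓡 n) x :=
  leviCivita (VectorField.mlieBracket (𝓡 n) X Y) Z x
    - (leviCivita X (leviCivita Y Z) x - leviCivita Y (leviCivita X Z) x)

/-- `R(v, w)z` for tangent vectors at `x`. -/
def curvature (x : M) (v w z : TangentSpace (𝓡 n) x) : TangentSpace (𝓡 n) x :=
  curvatureField (FiberBundle.extend (EuclideanSpace ℝ (Fin n)) v)
    (FiberBundle.extend (EuclideanSpace ℝ (Fin n)) w)
    (FiberBundle.extend (EuclideanSpace ℝ (Fin n)) z) x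

/-- The Ricci tensor `Ric(v, w) = tr_g (z ↦ R(v, z)w)`. -/
def ricci (x : M) (v w : TangentSpace (𝓡 n) x) : ℝ :=
  ∑ i, inner ℝ (curvature x v (onb x i) w) (onb x i)

variable (n) in
/-- The scalar curvature `R_g = tr_g Ric`. -/
def scalarCurvature (x : M) : ℝ := ∑ i, ricci (n := n) x (onb x i) (onb x i)

variable (n M) in
/-- The set of smooth almost complex structures on `M` compatible with the metric. -/
structure CompatibleACS where
  J : Π x : M, TangentSpace (𝓡 n) x →L[ℝ] TangentSpace (𝓡 n) x
  sq : ∀ x v, J x (J x v) = -v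
  compat : ∀ x v w, (inner ℝ (J x v) (J x w) : ℝ) = inner ℝ v w
  smooth : ContMDiff (𝓡 n)
    ((𝓡 n).prod 𝓘(ℝ, EuclideanSpace ℝ (Fin n) →L[ℝ] EuclideanSpace ℝ (Fin n))) ∞
    (fun x ↦ TotalSpace.mk' (EuclideanSpace ℝ (Fin n) →L[ℝ] EuclideanSpace ℝ (Fin n))
      (E := fun x : M ↦ TangentSpace (𝓡 n) x →L[ℝ] TangentSpace (𝓡 n) x) x (J x))

namespace CompatibleACS

/-- The `*`-Ricci tensor `Ric*(v, w) = tr_g (z ↦ -J (R(v, z)(J w)))`. -/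
def starRicci (J : CompatibleACS n M) (x : M) (v w : TangentSpace (𝓡 n) x) : ℝ :=
  ∑ i, inner ℝ (-(J.J x (curvature x v (onb x i) (J.J x w)))) (onb x i)

/-- The `*`-scalar curvature `R_g^* = tr_g Ric^*`. -/
def starScalarCurvature (J : CompatibleACS n M) (x : M) : ℝ :=
  ∑ i, J.starRicci x (onb x i) (onb x i)

/-- The holomorphic d-scalar curvature `S_J = R_g - R_g^*`. -/
def holomorphicDScalar (J : CompatibleACS n M) (x : M) : ℝ :=
  scalarCurvature n x - J.starScalarCurvature x

/-- The pointwise distance `|J x - J' x|_g = (∑_i |(J - J') e_i|²)^(1/2)`. -/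
def pointDist (J J' : CompatibleACS n M) (x : M) : ℝ :=
  √(∑ i, ‖J.J x (onb x i) - J'.J x (onb x i)‖ ^ 2)

/-- The `C^0` distance `sup_x |J x - J' x|_g`. -/
def c0Dist (J J' : CompatibleACS n M) : ℝ := ⨆ x : M, pointDist J J' x

theorem norm_apply (J : CompatibleACS n M) (x : M) (v : TangentSpace (𝓡 n) x) :
    ‖J.J x v‖ = ‖v‖ := by
  have h := J.compat x v v
  rw [real_inner_self_eq_norm_sq, real_inner_self_eq_norm_sq] at h
  exact (sq_eq_sq₀ (norm_nonneg _) (norm_nonneg _)).1 h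

theorem pointDist_nonneg (J J' : CompatibleACS n M) (x : M) : 0 ≤ pointDist J J' x :=
  Real.sqrt_nonneg _

theorem pointDist_eq (J J' : CompatibleACS n M) (x : M) :
    pointDist J J' x = dist
      (WithLp.toLp 2 fun i ↦ J.J x (onb x i) : PiLp 2 fun _ ↦ TangentSpace (𝓡 n) x)
      (WithLp.toLp 2 fun i ↦ J'.J x (onb x i)) := by
  rw [PiLp.dist_eq_of_L2]
  simp only [pointDist, dist_eq_norm]

theorem bddAbove_pointDist (J J' : CompatibleACS n M) :
    BddAbove (Set.range fun x : M ↦ pointDist J J' x) := by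
  refine ⟨√(n * 4), ?_⟩
  rintro _ ⟨x, rfl⟩
  refine Real.sqrt_le_sqrt ?_
  have hn : Module.finrank ℝ (TangentSpace (𝓡 n) x) = n :=
    finrank_euclideanSpace_fin (𝕜 := ℝ) (n := n)
  have h : ∀ i ∈ Finset.univ, ‖J.J x (onb x i) - J'.J x (onb x i)‖ ^ 2 ≤ (4 : ℝ) := by
    intro i _
    have h1 := norm_sub_le (J.J x (onb x i)) (J'.J x (onb x i))
    rw [norm_apply, norm_apply, (onb x).norm_eq_one] at h1
    nlinarith [norm_nonneg (J.J x (onb x i) - J'.J x (onb x i))]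
  refine (Finset.sum_le_card_nsmul _ _ _ h).trans (le_of_eq ?_)
  rw [Finset.card_univ, Fintype.card_fin, hn, nsmul_eq_mul]

theorem pointDist_le_c0Dist (J J' : CompatibleACS n M) (x : M) :
    pointDist J J' x ≤ c0Dist J J' :=
  le_ciSup (bddAbove_pointDist J J') x

theorem c0Dist_nonneg (J J' : CompatibleACS n M) : 0 ≤ c0Dist J J' :=
  Real.iSup_nonneg fun x ↦ pointDist_nonneg J J' x

theorem eq_of_pointDist_eq_zero {J J' : CompatibleACS n M} {x : M} (h : pointDist J J' x = 0) :
    J.J x = J'.J x := by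
  rw [pointDist_eq, dist_eq_zero] at h
  have h' : (J.J x : TangentSpace (𝓡 n) x →ₗ[ℝ] TangentSpace (𝓡 n) x) = J'.J x :=
    (onb x).toBasis.ext fun i ↦ by
      have := congrFun (congrArg WithLp.ofLp h) i
      simpa using this
  exact ContinuousLinearMap.coe_injective h'

/-- The `C^0` topology on compatible almost complex structures. -/
instance : MetricSpace (CompatibleACS n M) where
  dist := c0Dist
  dist_self J := by simp [c0Dist, pointDist]
  dist_comm J J' := by simp only [c0Dist, pointDist, norm_sub_rev]
  dist_triangle J₁ J₂ J₃ := by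
    refine Real.iSup_le (fun x ↦ ?_) (add_nonneg (c0Dist_nonneg _ _) (c0Dist_nonneg _ _))
    have h : pointDist J₁ J₃ x ≤ pointDist J₁ J₂ x + pointDist J₂ J₃ x := by
      rw [pointDist_eq, pointDist_eq, pointDist_eq]
      exact dist_triangle _ _ _
    linarith [pointDist_le_c0Dist J₁ J₂ x, pointDist_le_c0Dist J₂ J₃ x]
  eq_of_dist_eq_zero {J J'} h := by
    have hJ : J.J = J'.J := funext fun x ↦ eq_of_pointDist_eq_zero <|
      le_antisymm ((pointDist_le_c0Dist J J' x).trans_eq h) (pointDist_nonneg J J' x)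
    cases J; cases J'; cases hJ; rfl

end CompatibleACS

variable (n) in
/-- `|du|²_g` at `x`. -/
def normSqDifferential (u : M → ℝ) (x : M) : ℝ := ∑ i, mvfderiv (𝓡 n) u x (onb x i) ^ 2

/-- The density `√det (g_ij)` of the metric in the chart at `c`, at the point with coordinates
`y`. -/
def chartDensity (c : M) (y : EuclideanSpace ℝ (Fin n)) : ℝ :=
  √(Matrix.of fun i j : Fin n ↦
    (inner ℝ
      (mfderiv (𝓡 n) (𝓡 n) (extChartAt (𝓡 n) c).symm y (EuclideanSpace.single i (1 : ℝ)) :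
        TangentSpace (𝓡 n) ((extChartAt (𝓡 n) c).symm y))
      (mfderiv (𝓡 n) (𝓡 n) (extChartAt (𝓡 n) c).symm y (EuclideanSpace.single j (1 : ℝ)) :
        TangentSpace (𝓡 n) ((extChartAt (𝓡 n) c).symm y)) : ℝ)).det

variable [T2Space M] [SigmaCompactSpace M]

variable [MeasurableSpace M] [BorelSpace M]

variable (n M) in
/-- The Riemannian volume measure: for a partition of unity `ρ_c` subordinate to the charts `φ_c`,
`∫ f dV_g = ∑_c ∫ (ρ_c f)(φ_c⁻¹ y) √det (g_ij)(y) dy`. -/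
def riemannianVolume : Measure M :=
  Measure.sum fun c : M ↦
    (((volume : Measure (EuclideanSpace ℝ (Fin n))).restrict (extChartAt (𝓡 n) c).target).withDensity
      fun y ↦ ENNReal.ofReal
        (chartPartition n M c ((extChartAt (𝓡 n) c).symm y) * chartDensity c y)).map
      (extChartAt (𝓡 n) c).symm

variable (n) in
/-- `‖u‖_p = (∫ |u|^p dV_g)^(1/p)`. -/
def lpNorm (p : ℝ) (u : M → ℝ) : ℝ := (∫ x, |u x| ^ p ∂riemannianVolume n M) ^ (1 / p)

namespace CompatibleACS

/-- `Q_{g,J}(u) = ∫ (4|du|² + S_J u²) dV_g / ‖u‖_p²` with `p = 2n/(n-2)`. -/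
def Q (J : CompatibleACS n M) (u : M → ℝ) : ℝ :=
  (∫ x, (4 * normSqDifferential n u x + J.holomorphicDScalar x * u x ^ 2) ∂riemannianVolume n M)
    / lpNorm n (2 * n / (n - 2)) u ^ 2

/-- The set of values `Q_{g,J}(u)` for positive smooth functions `u`. -/
def QValues (J : CompatibleACS n M) : Set ℝ :=
  {q | ∃ u : M → ℝ, ContMDiff (𝓡 n) 𝓘(ℝ, ℝ) ∞ u ∧ (∀ x, 0 < u x) ∧ J.Q u = q}

/-- `Y(M, g, J) = inf {Q_{g,J}(u) : u ∈ C^∞(M), u > 0}`. -/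
def Y (J : CompatibleACS n M) : ℝ := sInf J.QValues

end CompatibleACS

end Metric

end HolomorphicYamabe

end

/-! Only the `*`-scalar curvature in `S_J` depends on `J`, and it is quadratic in `J`: it is the sum
of `g(R(eᵢ,eⱼ)Jeᵢ, Jeⱼ)` over an orthonormal basis. On a compact manifold `|R| ≤ K`, and `J` is an
isometry, so `|S_J - S_J'| ≤ 2n²K d(J,J')` pointwise (`abs_holomorphicDScalar_sub_le`). In `Q_J(u) -
Q_J'(u)` the gradient terms cancel, leaving `∫(S_J - S_J')u² / ‖u‖_p²`. Hölder gives `∫u² ≤ ‖u‖_p²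
Vol^(2/n)`, so `J ↦ Q_J(u)` is Lipschitz with a constant independent of `u` (`exists_abs_Q_sub_le`).
The same inequality bounds `Q_J` below, and an infimum of uniformly Lipschitz functions that is
finite is Lipschitz.

Most of the work justifies the analytic input. Curvature is defined by extending tangent vectors,
and traces use bases `onb x` chosen with no regularity in `x`. Curvature is shown to be a tensor
(`curvature_eq_curvatureField`) and traces to be basis independent. Everything can then be computed
in smooth local orthonormal frames, which yields the bound `K`, continuity of `S_J` and `|du|²`,
and, with finiteness of the volume, integrability. -/

noncomputable section

namespace HolomorphicYamabe

variable {n : ℕ} {M : Type*} [TopologicalSpace M] [ChartedSpace (EuclideanSpace ℝ (Fin n)) M]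
  [IsManifold (𝓡 n) ∞ M]

/-- Differentiability at `x` of a vector field. -/
abbrev FieldMDiffAt (X : Π x : M, TangentSpace (𝓡 n) x) (x : M) : Prop :=
  MDifferentiableAt (𝓡 n) ((𝓡 n).prod 𝓘(ℝ, EuclideanSpace ℝ (Fin n)))
    (fun y ↦ TotalSpace.mk' (EuclideanSpace ℝ (Fin n))
      (E := fun x : M ↦ TangentSpace (𝓡 n) x) y (X y)) x

theorem mdifferentiableAt_extend_tangent {x : M} (v : TangentSpace (𝓡 n) x) :
    FieldMDiffAt (FiberBundle.extend (EuclideanSpace ℝ (Fin n)) v) x :=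
  FiberBundle.mdifferentiableAt_extend ..

/-! ### The Levi-Civita connection: Koszul formula and Leibniz rules -/

section Connection

variable [RiemannianBundle (fun x : M ↦ TangentSpace (𝓡 n) x)]

/-- Every term of the Koszul formula sees `Y` only through its germ at `x`. This permits rewriting
the inner derivative in `∇_X ∇_Y Z` by identities valid near `x`. -/
theorem leviCivita_congr_right {X Y Y' : Π x : M, TangentSpace (𝓡 n) x} {x : M}
    (h : Y =ᶠ[𝓝 x] Y') : leviCivita X Y x = leviCivita X Y' x := by
  simp only [leviCivita]
  refine Finset.sum_congr rfl fun i _ ↦ ?_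
  set Z := FiberBundle.extend (EuclideanSpace ℝ (Fin n)) (onb x i)
  have h1 : (fun y ↦ (inner ℝ (Y y) (Z y) : ℝ)) =ᶠ[𝓝 x] fun y ↦ (inner ℝ (Y' y) (Z y) : ℝ) := by
    filter_upwards [h] with y hy
    rw [hy]
  have h2 : (fun y ↦ (inner ℝ (X y) (Y y) : ℝ)) =ᶠ[𝓝 x] fun y ↦ (inner ℝ (X y) (Y' y) : ℝ) := by
    filter_upwards [h] with y hy
    rw [hy]
  have e1 : mvfderiv (𝓡 n) (fun y ↦ (inner ℝ (Y y) (Z y) : ℝ)) x =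
      mvfderiv (𝓡 n) (fun y ↦ (inner ℝ (Y' y) (Z y) : ℝ)) x := by
    ext v
    simp only [mvfderiv, h1.mfderiv_eq]
    rfl
  have e2 : mvfderiv (𝓡 n) (fun y ↦ (inner ℝ (X y) (Y y) : ℝ)) x =
      mvfderiv (𝓡 n) (fun y ↦ (inner ℝ (X y) (Y' y) : ℝ)) x := by
    ext v
    simp only [mvfderiv, h2.mfderiv_eq]
    rfl
  have e3 : VectorField.mlieBracket (𝓡 n) X Y x = VectorField.mlieBracket (𝓡 n) X Y' x :=
    Filter.EventuallyEq.rfl.mlieBracket_vectorField_eq h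
  have e4 : VectorField.mlieBracket (𝓡 n) Y Z x = VectorField.mlieBracket (𝓡 n) Y' Z x :=
    h.mlieBracket_vectorField_eq Filter.EventuallyEq.rfl
  simp only [koszul]
  rw [e1, e2, e3, e4, h.self_of_nhds]

variable [IsContMDiffRiemannianBundle (𝓡 n) ∞ (EuclideanSpace ℝ (Fin n))
    (fun x : M ↦ TangentSpace (𝓡 n) x)]

variable {X X' Y Y' Z Z' : Π x : M, TangentSpace (𝓡 n) x} {x : M} {f : M → ℝ}

instance isContMDiffRiemannianBundle_one :
    IsContMDiffRiemannianBundle (𝓡 n) 1 (EuclideanSpace ℝ (Fin n))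
      (fun x : M ↦ TangentSpace (𝓡 n) x) :=
  IsContMDiffRiemannianBundle.of_le (n := ∞) (by simp)

theorem mdifferentiableAt_inner (hX : FieldMDiffAt X x) (hY : FieldMDiffAt Y x) :
    MDifferentiableAt (𝓡 n) 𝓘(ℝ, ℝ) (fun y ↦ (inner ℝ (X y) (Y y) : ℝ)) x :=
  hX.inner_bundle hY

theorem mvfderiv_inner_smul_left (hf : MDifferentiableAt (𝓡 n) 𝓘(ℝ, ℝ) f x) (hX : FieldMDiffAt X x)
    (hY : FieldMDiffAt Y x) (v : TangentSpace (𝓡 n) x) :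
    mvfderiv (𝓡 n) (fun y ↦ (inner ℝ ((f • X) y) (Y y) : ℝ)) x v =
      f x * mvfderiv (𝓡 n) (fun y ↦ (inner ℝ (X y) (Y y) : ℝ)) x v +
        inner ℝ (X x) (Y x) * mvfderiv (𝓡 n) f x v := by
  have h : (fun y ↦ (inner ℝ ((f • X) y) (Y y) : ℝ)) =
      f * fun y ↦ (inner ℝ (X y) (Y y) : ℝ) := by
    ext y
    simp [real_inner_smul_left]
  rw [h, mvfderiv_mul hf (mdifferentiableAt_inner hX hY)]
  simp

theorem mvfderiv_inner_smul_right (hf : MDifferentiableAt (𝓡 n) 𝓘(ℝ, ℝ) f x) (hX : FieldMDiffAt X x)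
    (hY : FieldMDiffAt Y x) (v : TangentSpace (𝓡 n) x) :
    mvfderiv (𝓡 n) (fun y ↦ (inner ℝ (X y) ((f • Y) y) : ℝ)) x v =
      f x * mvfderiv (𝓡 n) (fun y ↦ (inner ℝ (X y) (Y y) : ℝ)) x v +
        inner ℝ (X x) (Y x) * mvfderiv (𝓡 n) f x v := by
  have h (W : Π x : M, TangentSpace (𝓡 n) x) : (fun y ↦ (inner ℝ (X y) (W y) : ℝ)) =
      fun y ↦ inner ℝ (W y) (X y) := funext fun y ↦ real_inner_comm _ _
  rw [h, h, real_inner_comm (Y x)]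
  exact mvfderiv_inner_smul_left hf hY hX v

theorem mvfderiv_inner_add_left (hX : FieldMDiffAt X x) (hX' : FieldMDiffAt X' x)
    (hY : FieldMDiffAt Y x) (v : TangentSpace (𝓡 n) x) :
    mvfderiv (𝓡 n) (fun y ↦ (inner ℝ ((X + X') y) (Y y) : ℝ)) x v =
      mvfderiv (𝓡 n) (fun y ↦ (inner ℝ (X y) (Y y) : ℝ)) x v +
        mvfderiv (𝓡 n) (fun y ↦ (inner ℝ (X' y) (Y y) : ℝ)) x v := by
  have h : (fun y ↦ (inner ℝ ((X + X') y) (Y y) : ℝ)) =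
      (fun y ↦ (inner ℝ (X y) (Y y) : ℝ)) + fun y ↦ (inner ℝ (X' y) (Y y) : ℝ) := by
    ext y
    simp [inner_add_left]
  rw [h, mvfderiv_add (mdifferentiableAt_inner hX hY) (mdifferentiableAt_inner hX' hY)]
  simp

theorem mvfderiv_inner_add_right (hX : FieldMDiffAt X x) (hY : FieldMDiffAt Y x)
    (hY' : FieldMDiffAt Y' x) (v : TangentSpace (𝓡 n) x) :
    mvfderiv (𝓡 n) (fun y ↦ (inner ℝ (X y) ((Y + Y') y) : ℝ)) x v =
      mvfderiv (𝓡 n) (fun y ↦ (inner ℝ (X y) (Y y) : ℝ)) x v +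
        mvfderiv (𝓡 n) (fun y ↦ (inner ℝ (X y) (Y' y) : ℝ)) x v := by
  have h (W : Π x : M, TangentSpace (𝓡 n) x) : (fun y ↦ (inner ℝ (X y) (W y) : ℝ)) =
      fun y ↦ inner ℝ (W y) (X y) := funext fun y ↦ real_inner_comm _ _
  rw [h, h, h]
  exact mvfderiv_inner_add_left hY hY' hX v

/-- The derivatives of `f` from the metric terms cancel those from the two brackets. -/
theorem koszul_smul_left (hf : MDifferentiableAt (𝓡 n) 𝓘(ℝ, ℝ) f x)
    (hX : FieldMDiffAt X x) (hY : FieldMDiffAt Y x)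
    (hZ : FieldMDiffAt Z x) : koszul (f • X) Y Z x = f x * koszul X Y Z x := by
  simp only [koszul]
  rw [mvfderiv_inner_smul_left hf hX hZ, mvfderiv_inner_smul_left hf hX hY,
    VectorField.mlieBracket_smul_left hf hX, VectorField.mlieBracket_smul_left hf hX]
  simp only [Pi.smul_apply', map_smul, inner_add_left, real_inner_smul_left, inner_smul_right,
    smul_eq_mul]
  ring

theorem koszul_add_left (hX : FieldMDiffAt X x) (hX' : FieldMDiffAt X' x)
    (hY : FieldMDiffAt Y x) (hZ : FieldMDiffAt Z x) :
    koszul (X + X') Y Z x = koszul X Y Z x + koszul X' Y Z x := by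
  simp only [koszul]
  rw [mvfderiv_inner_add_left hX hX' hZ, mvfderiv_inner_add_left hX hX' hY,
    VectorField.mlieBracket_add_left hX hX', VectorField.mlieBracket_add_left hX hX']
  simp only [Pi.add_apply, map_add, inner_add_left, inner_add_right]
  ring

/-- The terms in `Zf` cancel; `(Xf) g(Y,Z)` appears twice, once from the metric and once from `[X,
fY]`, and the division by 2 leaves the Leibniz term. -/
theorem koszul_smul_middle (hf : MDifferentiableAt (𝓡 n) 𝓘(ℝ, ℝ) f x)
    (hX : FieldMDiffAt X x) (hY : FieldMDiffAt Y x)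
    (hZ : FieldMDiffAt Z x) : koszul X (f • Y) Z x =
      f x * koszul X Y Z x + mvfderiv (𝓡 n) f x (X x) * inner ℝ (Y x) (Z x) := by
  simp only [koszul]
  rw [mvfderiv_inner_smul_left hf hY hZ, mvfderiv_inner_smul_right hf hX hY,
    VectorField.mlieBracket_smul_right hf hY, VectorField.mlieBracket_smul_left hf hY]
  simp only [Pi.smul_apply', map_smul, inner_add_left, real_inner_smul_left, inner_smul_right,
    smul_eq_mul]
  rw [real_inner_comm (Y x) (X x)]
  ring

theorem koszul_add_middle (hX : FieldMDiffAt X x) (hY : FieldMDiffAt Y x)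
    (hY' : FieldMDiffAt Y' x) (hZ : FieldMDiffAt Z x) :
    koszul X (Y + Y') Z x = koszul X Y Z x + koszul X Y' Z x := by
  simp only [koszul]
  rw [mvfderiv_inner_add_left hY hY' hZ, mvfderiv_inner_add_right hX hY hY',
    VectorField.mlieBracket_add_right hY hY', VectorField.mlieBracket_add_left hY hY']
  simp only [Pi.add_apply, map_add, inner_add_left, inner_add_right]
  ring

theorem koszul_smul_right (hf : MDifferentiableAt (𝓡 n) 𝓘(ℝ, ℝ) f x)
    (hX : FieldMDiffAt X x) (hY : FieldMDiffAt Y x)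
    (hZ : FieldMDiffAt Z x) : koszul X Y (f • Z) x = f x * koszul X Y Z x := by
  simp only [koszul]
  rw [mvfderiv_inner_smul_right hf hY hZ, mvfderiv_inner_smul_right hf hX hZ,
    VectorField.mlieBracket_smul_right hf hZ, VectorField.mlieBracket_smul_right hf hZ]
  simp only [Pi.smul_apply', map_smul, inner_add_left, real_inner_smul_left, inner_smul_right,
    smul_eq_mul]
  rw [real_inner_comm (Y x) (Z x), real_inner_comm (X x) (Z x)]
  ring

theorem koszul_add_right (hX : FieldMDiffAt X x) (hY : FieldMDiffAt Y x)
    (hZ : FieldMDiffAt Z x) (hZ' : FieldMDiffAt Z' x) :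
    koszul X Y (Z + Z') x = koszul X Y Z x + koszul X Y Z' x := by
  simp only [koszul]
  rw [mvfderiv_inner_add_right hY hZ hZ', mvfderiv_inner_add_right hX hZ hZ',
    VectorField.mlieBracket_add_right hZ hZ', VectorField.mlieBracket_add_right hZ hZ']
  simp only [Pi.add_apply, map_add, inner_add_left, inner_add_right]
  ring

theorem tensorialAt_koszul_right (hX : FieldMDiffAt X x) (hY : FieldMDiffAt Y x) :
    TensorialAt (𝓡 n) (EuclideanSpace ℝ (Fin n)) (fun Z ↦ koszul X Y Z x) x where
  smul hf hσ := koszul_smul_right hf hX hY hσ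
  add hσ hσ' := koszul_add_right hX hY hσ hσ'

/-- The Koszul formula characterizes the Levi-Civita connection. -/
theorem inner_leviCivita (hX : FieldMDiffAt X x) (hY : FieldMDiffAt Y x)
    (hZ : FieldMDiffAt Z x) : inner ℝ (leviCivita X Y x) (Z x) = koszul X Y Z x := by
  -- Tensoriality in `Z` reduces the claim to the extensions of the basis vectors, which are the
  -- fields used in the definition.
  have hT := tensorialAt_koszul_right hX hY
  rw [← hT.mkHom_apply hZ]
  conv_rhs => rw [← (onb x).sum_repr' (Z x), map_sum]
  simp only [map_smul, smul_eq_mul]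
  simp only [leviCivita, sum_inner, hT.mkHom_apply_eq_extend, real_inner_smul_left]
  exact Finset.sum_congr rfl fun i _ ↦ mul_comm _ _

theorem leviCivita_smul_left (hf : MDifferentiableAt (𝓡 n) 𝓘(ℝ, ℝ) f x) (hX : FieldMDiffAt X x)
    (hY : FieldMDiffAt Y x) : leviCivita (f • X) Y x = f x • leviCivita X Y x := by
  simp only [leviCivita, Finset.smul_sum, smul_smul]
  refine Finset.sum_congr rfl fun i _ ↦ ?_
  rw [koszul_smul_left hf hX hY (mdifferentiableAt_extend_tangent _)]

theorem leviCivita_add_left (hX : FieldMDiffAt X x) (hX' : FieldMDiffAt X' x)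
    (hY : FieldMDiffAt Y x) :
    leviCivita (X + X') Y x = leviCivita X Y x + leviCivita X' Y x := by
  simp only [leviCivita, ← Finset.sum_add_distrib, ← add_smul]
  refine Finset.sum_congr rfl fun i _ ↦ ?_
  rw [koszul_add_left hX hX' hY (mdifferentiableAt_extend_tangent _)]

theorem leviCivita_smul_right (hf : MDifferentiableAt (𝓡 n) 𝓘(ℝ, ℝ) f x) (hX : FieldMDiffAt X x)
    (hY : FieldMDiffAt Y x) : leviCivita X (f • Y) x =
      f x • leviCivita X Y x + mvfderiv (𝓡 n) f x (X x) • Y x := by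
  conv_rhs => rw [← (onb x).sum_repr' (Y x)]
  simp only [leviCivita, Finset.smul_sum, smul_smul, ← Finset.sum_add_distrib, ← add_smul]
  refine Finset.sum_congr rfl fun i _ ↦ ?_
  rw [koszul_smul_middle hf hX hY (mdifferentiableAt_extend_tangent _),
    FiberBundle.extend_apply_self, real_inner_comm]

theorem leviCivita_add_right (hX : FieldMDiffAt X x) (hY : FieldMDiffAt Y x)
    (hY' : FieldMDiffAt Y' x) :
    leviCivita X (Y + Y') x = leviCivita X Y x + leviCivita X Y' x := by
  simp only [leviCivita, ← Finset.sum_add_distrib, ← add_smul]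
  refine Finset.sum_congr rfl fun i _ ↦ ?_
  rw [koszul_add_middle hX hY hY' (mdifferentiableAt_extend_tangent _)]

theorem tensorialAt_leviCivita (hY : FieldMDiffAt Y x) :
    TensorialAt (𝓡 n) (EuclideanSpace ℝ (Fin n)) (fun X ↦ leviCivita X Y x) x where
  smul hf hσ := leviCivita_smul_left hf hσ hY
  add hσ hσ' := leviCivita_add_left hσ hσ' hY

end Connection

end HolomorphicYamabe

end

/-! ### Smooth fields on open sets and smooth orthonormal frames -/

noncomputable section

namespace HolomorphicYamabe

variable {n : ℕ} {M : Type*} [TopologicalSpace M] [ChartedSpace (EuclideanSpace ℝ (Fin n)) M]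

theorem finrank_tangentSpace (x : M) : Module.finrank ℝ (TangentSpace (𝓡 n) x) = n :=
  finrank_euclideanSpace_fin (𝕜 := ℝ) (n := n)

variable (n) in
/-- The function `f` is smooth at every point of `U`. -/
def SmoothFunOn (U : Set M) (f : M → ℝ) : Prop :=
  ∀ x ∈ U, ContMDiffAt (𝓡 n) 𝓘(ℝ, ℝ) ∞ f x

section Smooth

variable {U V : Set M} {f g : M → ℝ} {x : M}

namespace SmoothFunOn

theorem mdifferentiableAt (hf : SmoothFunOn n U f) (hx : x ∈ U) :
    MDifferentiableAt (𝓡 n) 𝓘(ℝ, ℝ) f x := (hf x hx).mdifferentiableAt (by simp)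

theorem congr (hf : SmoothFunOn n U f) (hU : IsOpen U) (h : ∀ y ∈ U, g y = f y) :
    SmoothFunOn n U g := fun x hx ↦
  (hf x hx).congr_of_eventuallyEq (Filter.eventually_of_mem (hU.mem_nhds hx) h)

theorem continuousOn (hf : SmoothFunOn n U f) : ContinuousOn f U :=
  fun x hx ↦ (hf x hx).continuousAt.continuousWithinAt

/-- The indicator is locally constant on the open set `U`, and nothing is required outside. It
serves as a cutoff that discards the values of a field off `U`, with no bump function. -/
theorem indicator_one (hU : IsOpen U) : SmoothFunOn n U (U.indicator 1) := by
  have h1 : SmoothFunOn n U (fun _ ↦ (1 : ℝ)) := fun x _ ↦ contMDiffAt_const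
  exact h1.congr hU fun y hy ↦ by simp [hy]

theorem add (hf : SmoothFunOn n U f) (hg : SmoothFunOn n U g) :
    SmoothFunOn n U fun x ↦ f x + g x := fun x hx ↦ (hf x hx).add (hg x hx)

theorem sub (hf : SmoothFunOn n U f) (hg : SmoothFunOn n U g) :
    SmoothFunOn n U fun x ↦ f x - g x := fun x hx ↦ (hf x hx).sub (hg x hx)

theorem div_const (hf : SmoothFunOn n U f) (c : ℝ) : SmoothFunOn n U fun x ↦ f x / c :=
  fun x hx ↦ (hf x hx).div_const c

theorem mul (hf : SmoothFunOn n U f) (hg : SmoothFunOn n U g) :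
    SmoothFunOn n U fun x ↦ f x * g x := fun x hx ↦ (hf x hx).mul (hg x hx)

theorem inv (hf : SmoothFunOn n U f) (h0 : ∀ y ∈ U, f y ≠ 0) :
    SmoothFunOn n U fun x ↦ (f x)⁻¹ := fun x hx ↦ (hf x hx).inv₀ (h0 x hx)

theorem sqrt (hf : SmoothFunOn n U f) (h0 : ∀ y ∈ U, f y ≠ 0) :
    SmoothFunOn n U fun x ↦ √(f x) := fun x hx ↦
  (Real.contDiffAt_sqrt (h0 x hx)).contMDiffAt.comp x (hf x hx)

theorem sum {ι : Type*} {s : Finset ι} {f : ι → M → ℝ} (hf : ∀ i ∈ s, SmoothFunOn n U (f i)) :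
    SmoothFunOn n U fun x ↦ ∑ i ∈ s, f i x := fun x hx ↦
  ContMDiffAt.sum fun i hi ↦ hf i hi x hx

end SmoothFunOn

end Smooth

variable [IsManifold (𝓡 n) ∞ M]

/-- The vector field `X` is smooth at every point of `U`. -/
def SmoothFieldOn (U : Set M) (X : Π x : M, TangentSpace (𝓡 n) x) : Prop :=
  ∀ x ∈ U, ContMDiffAt (𝓡 n) ((𝓡 n).prod 𝓘(ℝ, EuclideanSpace ℝ (Fin n))) ∞
    (fun y ↦ TotalSpace.mk' (EuclideanSpace ℝ (Fin n))
      (E := fun x : M ↦ TangentSpace (𝓡 n) x) y (X y)) x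

section SmoothField

variable {U V : Set M} {X Y Z : Π x : M, TangentSpace (𝓡 n) x} {f g : M → ℝ} {x : M}

namespace SmoothFieldOn

theorem mono (hX : SmoothFieldOn V X) (h : U ⊆ V) : SmoothFieldOn U X := fun x hx ↦ hX x (h hx)

theorem fieldMDiffAt (hX : SmoothFieldOn U X) (hx : x ∈ U) : FieldMDiffAt X x :=
  (hX x hx).mdifferentiableAt (by simp)

theorem congr (hX : SmoothFieldOn U X) (hU : IsOpen U) (h : ∀ y ∈ U, Y y = X y) :
    SmoothFieldOn U Y := fun x hx ↦
  (hX x hx).congr_of_eventuallyEq <| Filter.eventually_of_mem (hU.mem_nhds hx) fun y hy ↦ by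
    simp only [h y hy]

theorem add (hX : SmoothFieldOn U X) (hY : SmoothFieldOn U Y) : SmoothFieldOn U (X + Y) :=
  fun x hx ↦ (hX x hx).add_section (hY x hx)

theorem sub (hX : SmoothFieldOn U X) (hY : SmoothFieldOn U Y) : SmoothFieldOn U (X - Y) :=
  fun x hx ↦ (hX x hx).sub_section (hY x hx)

theorem smul (hf : SmoothFunOn n U f) (hX : SmoothFieldOn U X) : SmoothFieldOn U (f • X) :=
  fun x hx ↦ (hf x hx).smul_section (hX x hx)

theorem sum {ι : Type*} {s : Finset ι} {X : ι → Π x : M, TangentSpace (𝓡 n) x}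
    (hX : ∀ i ∈ s, SmoothFieldOn U (X i)) : SmoothFieldOn U (fun x ↦ ∑ i ∈ s, X i x) :=
  fun x hx ↦ ContMDiffAt.sum_section fun i hi ↦ hX i hi x hx

theorem mlieBracket (hX : SmoothFieldOn U X) (hY : SmoothFieldOn U Y) :
    SmoothFieldOn U (VectorField.mlieBracket (𝓡 n) X Y) := fun x hx ↦ by
  have : IsManifold (𝓡 n) (((⊤ : ℕ∞) : WithTop ℕ∞) + 1) M := by simpa
  have : IsManifold (𝓡 n) (minSmoothness ℝ 2) M := .of_le (n := ∞) (by
    rw [minSmoothness_of_isRCLikeNormedField]; exact ENat.LEInfty.out)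
  exact (hX x hx).mlieBracket_vectorField (m := ⊤) (n := ⊤) (hY x hx) (by simp)

theorem mvfderiv (hf : SmoothFunOn n U f) (hX : SmoothFieldOn U X) :
    SmoothFunOn n U (fun x ↦ mvfderiv (𝓡 n) f x (X x)) := fun x hx ↦ by
  have h1 := (hf x hx).mfderiv_const (m := ∞) (by simp)
  have h2 := ContMDiffAt.clm_apply_of_inCoordinates h1 (hX x hx) (hf x hx)
  rw [contMDiffAt_totalSpace] at h2
  simpa using! h2.2

/-- The extension is constant in the trivialization at `x`, hence smooth on the whole base set and
not only near `x`. -/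
theorem extend (v : TangentSpace (𝓡 n) x) : SmoothFieldOn
    (trivializationAt (EuclideanSpace ℝ (Fin n)) (fun x : M ↦ TangentSpace (𝓡 n) x) x).baseSet
    (FiberBundle.extend (EuclideanSpace ℝ (Fin n)) v) := by
  intro y hy
  set t := trivializationAt (EuclideanSpace ℝ (Fin n)) (fun x : M ↦ TangentSpace (𝓡 n) x) x
  rw [t.contMDiffAt_section_iff hy]
  exact (contMDiffAt_const (c := (t ⟨x, v⟩).2)).congr_of_eventuallyEq <|
    Filter.eventually_of_mem (t.open_baseSet.mem_nhds hy) fun z hz ↦ by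
      have h := congrArg Prod.snd (t.apply_mk_symm hz (t ⟨x, v⟩).2)
      exact h

variable [RiemannianBundle (fun x : M ↦ TangentSpace (𝓡 n) x)]
  [IsContMDiffRiemannianBundle (𝓡 n) ∞ (EuclideanSpace ℝ (Fin n))
    (fun x : M ↦ TangentSpace (𝓡 n) x)]

theorem inner (hX : SmoothFieldOn U X) (hY : SmoothFieldOn U Y) :
    SmoothFunOn n U (fun y ↦ (inner ℝ (X y) (Y y) : ℝ)) :=
  fun x hx ↦ (hX x hx).inner_bundle (hY x hx)

theorem koszul (hX : SmoothFieldOn U X) (hY : SmoothFieldOn U Y) (hZ : SmoothFieldOn U Z) :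
    SmoothFunOn n U (koszul X Y Z) :=
  ((((((mvfderiv (hY.inner hZ) hX).add (mvfderiv (hX.inner hZ) hY)).sub
    (mvfderiv (hX.inner hY) hZ)).add ((hX.mlieBracket hY).inner hZ)).sub
    ((hX.mlieBracket hZ).inner hY)).sub ((hY.mlieBracket hZ).inner hX)).div_const 2

end SmoothFieldOn

end SmoothField

section Frame

variable [RiemannianBundle (fun x : M ↦ TangentSpace (𝓡 n) x)]

/-- A smooth orthonormal frame of the tangent bundle over the open set `U`. -/
structure OrthonormalFrameOn (U : Set M) (e : Fin n → Π x : M, TangentSpace (𝓡 n) x) : Prop where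
  isOpen : IsOpen U
  smooth : ∀ i, SmoothFieldOn U (e i)
  orthonormal : ∀ x ∈ U, Orthonormal ℝ (fun i ↦ e i x)

namespace OrthonormalFrameOn

variable {U V : Set M} {e : Fin n → Π x : M, TangentSpace (𝓡 n) x} {x : M}
  {X : Π x : M, TangentSpace (𝓡 n) x}

theorem mono (h : OrthonormalFrameOn U e) (hV : IsOpen V) (hVU : V ⊆ U) :
    OrthonormalFrameOn V e :=
  ⟨hV, fun i ↦ (h.smooth i).mono hVU, fun x hx ↦ h.orthonormal x (hVU hx)⟩

/-- The orthonormal basis of `T_x M` given by an orthonormal frame. -/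
def basis (h : OrthonormalFrameOn U e) (hx : x ∈ U) :
    OrthonormalBasis (Fin n) ℝ (TangentSpace (𝓡 n) x) :=
  OrthonormalBasis.mk (h.orthonormal x hx) <|
    ((h.orthonormal x hx).linearIndependent.span_eq_top_of_card_eq_finrank'
      (by rw [finrank_tangentSpace, Fintype.card_fin])).ge

@[simp]
theorem basis_apply (h : OrthonormalFrameOn U e) (hx : x ∈ U) (i : Fin n) :
    h.basis hx i = e i x := by
  simp [basis]

theorem eq_sum (h : OrthonormalFrameOn U e) (hx : x ∈ U) :
    X x = ∑ i, (inner ℝ (e i x) (X x) : ℝ) • e i x := by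
  simpa using ((h.basis hx).sum_repr' (X x)).symm

end OrthonormalFrameOn

variable [IsContMDiffRiemannianBundle (𝓡 n) ∞ (EuclideanSpace ℝ (Fin n))
    (fun x : M ↦ TangentSpace (𝓡 n) x)]

/-- By strong induction, each projection subtracted has smooth coefficients, since linear
independence keeps the denominators away from zero. -/
theorem SmoothFieldOn.gramSchmidt {U : Set M} (hU : IsOpen U)
    {s : Fin n → Π x : M, TangentSpace (𝓡 n) x} (hs : ∀ i, SmoothFieldOn U (s i))
    (hli : ∀ x ∈ U, LinearIndependent ℝ (fun i ↦ s i x)) (i : Fin n) :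
    SmoothFieldOn U (fun x ↦ InnerProductSpace.gramSchmidt ℝ (fun j ↦ s j x) i) := by
  induction i using WellFoundedLT.induction with
  | _ i ih =>
    have h0 (j) (y) (hy : y ∈ U) : Inner.inner ℝ (InnerProductSpace.gramSchmidt ℝ (fun k ↦ s k y) j)
        (InnerProductSpace.gramSchmidt ℝ (fun k ↦ s k y) j) ≠ 0 := by
      simpa using InnerProductSpace.gramSchmidt_ne_zero j (hli y hy)
    refine ((hs i).sub (.sum (s := Finset.Iio i) fun j hj ↦ ?_)).congr hU
      (Y := fun x ↦ InnerProductSpace.gramSchmidt ℝ (fun j ↦ s j x) i)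
      (fun y _ ↦ InnerProductSpace.gramSchmidt_def ℝ _ i)
    have hj' := ih j (Finset.mem_Iio.1 hj)
    refine (SmoothFieldOn.smul ((hj'.inner (hs i)).mul ((hj'.inner hj').inv (h0 j))) hj').congr hU
      fun y _ ↦ ?_
    rw [Submodule.starProjection_singleton]
    simp [div_eq_mul_inv]

/-- Gram–Schmidt applied to a local frame. It replaces the pointwise bases `onb x`, which may vary
discontinuously. -/
theorem exists_orthonormalFrameOn (x : M) :
    ∃ (U : Set M) (e : Fin n → Π x : M, TangentSpace (𝓡 n) x),
      x ∈ U ∧ OrthonormalFrameOn U e := by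
  set t := trivializationAt (EuclideanSpace ℝ (Fin n)) (fun x : M ↦ TangentSpace (𝓡 n) x) x
  let b := (EuclideanSpace.basisFun (Fin n) ℝ).toBasis
  have hF := t.isLocalFrameOn_localFrame_baseSet (𝓡 n) ∞ b
  have hs (i) : SmoothFieldOn t.baseSet (t.localFrame b i) :=
    fun y hy ↦ hF.contMDiffAt t.open_baseSet hy i
  have hli (y) (hy : y ∈ t.baseSet) : LinearIndependent ℝ (fun i ↦ t.localFrame b i y) :=
    hF.linearIndependent hy
  have hg := SmoothFieldOn.gramSchmidt t.open_baseSet hs hli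
  refine ⟨t.baseSet, fun i y ↦ InnerProductSpace.gramSchmidtNormed ℝ
    (fun j ↦ t.localFrame b j y) i, FiberBundle.mem_baseSet_trivializationAt' x,
    t.open_baseSet, fun i ↦ ?_, fun y hy ↦
      InnerProductSpace.gramSchmidtNormed_orthonormal (hli y hy)⟩
  have h0 (y) (hy : y ∈ t.baseSet) : InnerProductSpace.gramSchmidt ℝ
      (fun j ↦ t.localFrame b j y) i ≠ 0 := InnerProductSpace.gramSchmidt_ne_zero _ (hli y hy)
  have h1 := ((hg i).inner (hg i))
  have h2 := (h1.sqrt fun y hy ↦ by simpa using h0 y hy).inv fun y hy ↦ by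
    rw [← norm_eq_sqrt_real_inner]
    simpa using h0 y hy
  refine (SmoothFieldOn.smul h2 (hg i)).congr t.open_baseSet fun y hy ↦ ?_
  rw [InnerProductSpace.gramSchmidtNormed, norm_eq_sqrt_real_inner]
  rfl

/-- In a smooth orthonormal frame the coefficients of `∇_X Y` are Koszul expressions, hence smooth.
-/
theorem SmoothFieldOn.leviCivita {U : Set M} (hU : IsOpen U)
    {X Y : Π x : M, TangentSpace (𝓡 n) x} (hX : SmoothFieldOn U X) (hY : SmoothFieldOn U Y) :
    SmoothFieldOn U (HolomorphicYamabe.leviCivita X Y) := by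
  intro x hx
  obtain ⟨V, e, hxV, he⟩ := exists_orthonormalFrameOn (n := n) x
  have he' := he.mono (hU.inter he.isOpen) Set.inter_subset_right
  have hX' := hX.mono (V := U) (U := U ∩ V) Set.inter_subset_left
  have hY' := hY.mono (V := U) (U := U ∩ V) Set.inter_subset_left
  refine SmoothFieldOn.congr (X := fun y ↦ ∑ i, HolomorphicYamabe.koszul X Y (e i) y • e i y)
    (.sum fun i _ ↦ .smul (hX'.koszul hY' (he'.smooth i)) (he'.smooth i)) he'.isOpen
    (fun y hy ↦ ?_) x ⟨hx, hxV⟩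
  rw [he'.eq_sum (X := HolomorphicYamabe.leviCivita X Y) hy]
  refine Finset.sum_congr rfl fun i _ ↦ ?_
  rw [real_inner_comm, inner_leviCivita (hX'.fieldMDiffAt hy) (hY'.fieldMDiffAt hy)
    ((he'.smooth i).fieldMDiffAt hy)]

end Frame

end HolomorphicYamabe

end

/-! ### Tensoriality of the curvature -/

noncomputable section

namespace HolomorphicYamabe

variable {n : ℕ} {M : Type*} [TopologicalSpace M] [ChartedSpace (EuclideanSpace ℝ (Fin n)) M]
  [IsManifold (𝓡 n) ∞ M]

/-- The bracket of vector fields acts on functions as the commutator. -/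
theorem mvfderiv_mlieBracket_smul {U : Set M} {X Y Z : Π x : M, TangentSpace (𝓡 n) x} {x : M}
    {f : M → ℝ} (hU : IsOpen U) (hx : x ∈ U) (hf : SmoothFunOn n U f)
    (hX : SmoothFieldOn U X) (hY : SmoothFieldOn U Y) (hZ : SmoothFieldOn U Z) :
    mvfderiv (𝓡 n) f x (VectorField.mlieBracket (𝓡 n) X Y x) • Z x =
      (mvfderiv (𝓡 n) (fun y ↦ mvfderiv (𝓡 n) f y (Y y)) x (X x)
        - mvfderiv (𝓡 n) (fun y ↦ mvfderiv (𝓡 n) f y (X y)) x (Y x)) • Z x := by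
  have hm : IsManifold (𝓡 n) (minSmoothness ℝ 3) M := .of_le (n := ∞) (by
    rw [minSmoothness_of_isRCLikeNormedField]; exact ENat.LEInfty.out)
  have hle : minSmoothness ℝ 2 ≤ ∞ := by
    rw [minSmoothness_of_isRCLikeNormedField]; exact ENat.LEInfty.out
  have df := hf.mdifferentiableAt hx
  have dZ := hZ.fieldMDiffAt hx
  have sfZ := SmoothFieldOn.smul hf hZ
  -- Second-order Leibniz expansion of `[V, [W, fZ]]`; its first-order terms are symmetric in `V`
  -- and `W`.
  have key {V W : Π x : M, TangentSpace (𝓡 n) x} (hV : SmoothFieldOn U V)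
      (hW : SmoothFieldOn U W) :
      VectorField.mlieBracket (𝓡 n) V (VectorField.mlieBracket (𝓡 n) W (f • Z)) x =
        mvfderiv (𝓡 n) (fun y ↦ mvfderiv (𝓡 n) f y (W y)) x (V x) • Z x +
        mvfderiv (𝓡 n) f x (W x) • VectorField.mlieBracket (𝓡 n) V Z x +
        (mvfderiv (𝓡 n) f x (V x) • VectorField.mlieBracket (𝓡 n) W Z x +
        f x • VectorField.mlieBracket (𝓡 n) V (VectorField.mlieBracket (𝓡 n) W Z) x) := by
    have sWf := SmoothFieldOn.mvfderiv hf hW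
    have h1 : VectorField.mlieBracket (𝓡 n) V (VectorField.mlieBracket (𝓡 n) W (f • Z)) x =
        VectorField.mlieBracket (𝓡 n) V ((fun y ↦ mvfderiv (𝓡 n) f y (W y)) • Z +
          f • VectorField.mlieBracket (𝓡 n) W Z) x :=
      Filter.EventuallyEq.rfl.mlieBracket_vectorField_eq <|
        Filter.eventually_of_mem (hU.mem_nhds hx) fun y hy ↦
          VectorField.mlieBracket_smul_right (hf.mdifferentiableAt hy) (hZ.fieldMDiffAt hy)
    rw [h1, VectorField.mlieBracket_add_right ((SmoothFieldOn.smul sWf hZ).fieldMDiffAt hx)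
        ((SmoothFieldOn.smul hf (hW.mlieBracket hZ)).fieldMDiffAt hx),
      VectorField.mlieBracket_smul_right (sWf.mdifferentiableAt hx) dZ,
      VectorField.mlieBracket_smul_right df ((hW.mlieBracket hZ).fieldMDiffAt hx)]
  -- Compare the Jacobi identity for `X, Y, fZ` with `f` times the one for `X, Y, Z`: the
  -- first-order terms cancel and only multiples of `Z x` remain.
  have J1 := VectorField.leibniz_identity_mlieBracket_apply ((hX x hx).of_le hle)
    ((hY x hx).of_le hle) ((sfZ x hx).of_le hle)
  have J2 := VectorField.leibniz_identity_mlieBracket_apply ((hX x hx).of_le hle)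
    ((hY x hx).of_le hle) ((hZ x hx).of_le hle)
  rw [key hX hY, key hY hX, VectorField.mlieBracket_smul_right df dZ, J2] at J1
  rw [sub_smul, eq_sub_iff_add_eq, ← sub_eq_zero]
  rw [← sub_eq_zero] at J1
  rw [← neg_eq_zero, ← J1]
  module

section Tensorial

/-- A map on vector fields that is linear over germs of functions when restricted to fields and
functions that are smooth on `U`. -/
structure SmoothTensorialAt (U : Set M) (x : M)
    (Φ : (Π x : M, TangentSpace (𝓡 n) x) → TangentSpace (𝓡 n) x) : Prop where
  smul : ∀ {f : M → ℝ} {X}, SmoothFunOn n U f → SmoothFieldOn U X → Φ (f • X) = f x • Φ X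
  add : ∀ {X Y}, SmoothFieldOn U X → SmoothFieldOn U Y → Φ (X + Y) = Φ X + Φ Y

namespace SmoothTensorialAt

variable {U : Set M} {x : M} {Φ : (Π x : M, TangentSpace (𝓡 n) x) → TangentSpace (𝓡 n) x}
  {X Y : Π x : M, TangentSpace (𝓡 n) x}

/-- Multiplying by the indicator of `U` makes the two fields equal everywhere and multiplies `Φ` by
1. -/
theorem congr (hΦ : SmoothTensorialAt U x Φ) (hU : IsOpen U) (hx : x ∈ U)
    (hX : SmoothFieldOn U X) (hY : SmoothFieldOn U Y) (h : ∀ y ∈ U, X y = Y y) : Φ X = Φ Y := by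
  have h1 := SmoothFunOn.indicator_one (n := n) hU
  have h2 : U.indicator (1 : M → ℝ) • X = U.indicator (1 : M → ℝ) • Y := by
    ext1 y
    by_cases hy : y ∈ U <;> simp [hy, h]
  have h3 := hΦ.smul h1 hX
  rw [h2, hΦ.smul h1 hY] at h3
  simpa [hx] using h3.symm

theorem sum (hΦ : SmoothTensorialAt U x Φ) {ι : Type*} (s : Finset ι)
    {X : ι → Π x : M, TangentSpace (𝓡 n) x} (hX : ∀ i, SmoothFieldOn U (X i)) :
    Φ (fun y ↦ ∑ i ∈ s, X i y) = ∑ i ∈ s, Φ (X i) := by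
  classical
  induction s using Finset.induction_on with
  | empty =>
    have h : SmoothFieldOn U fun y ↦ ∑ i ∈ (∅ : Finset ι), X i y := .sum fun i hi ↦ hX i
    -- `Φ 0 = 0` comes from homogeneity with the zero function.
    have h1 := hΦ.smul (f := fun _ ↦ 0) (fun x _ ↦ contMDiffAt_const) h
    rw [zero_smul] at h1
    rw [Finset.sum_empty, ← h1]
    congr 1
    ext1 y
    simp
  | insert a s ha ih =>
    rw [Finset.sum_insert ha, ← ih, ← hΦ.add (hX a) (.sum fun i _ ↦ hX i)]
    congr 1
    ext1 y
    rw [Finset.sum_insert ha, Pi.add_apply]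

variable [RiemannianBundle (fun x : M ↦ TangentSpace (𝓡 n) x)]
  [IsContMDiffRiemannianBundle (𝓡 n) ∞ (EuclideanSpace ℝ (Fin n))
    (fun x : M ↦ TangentSpace (𝓡 n) x)]

theorem eq_sum (hΦ : SmoothTensorialAt U x Φ) {e : Fin n → Π x : M, TangentSpace (𝓡 n) x}
    (he : OrthonormalFrameOn U e) (hx : x ∈ U) (hX : SmoothFieldOn U X) :
    Φ X = ∑ i, (inner ℝ (e i x) (X x) : ℝ) • Φ (e i) := by
  have hc (i) : SmoothFunOn n U fun y ↦ (inner ℝ (e i y) (X y) : ℝ) := (he.smooth i).inner hX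
  have hs (i) := SmoothFieldOn.smul (hc i) (he.smooth i)
  rw [hΦ.congr he.isOpen hx hX (.sum fun i _ ↦ hs i) fun y hy ↦ he.eq_sum hy, hΦ.sum _ hs]
  exact Finset.sum_congr rfl fun i _ ↦ hΦ.smul (hc i) (he.smooth i)

/-- Expanding in a frame expresses `Φ X` through `X x` alone. Fields smooth on all of `U` are used
because curvature differentiates twice, so differentiability at `x` alone is not enough. -/
theorem pointwise (hΦ : SmoothTensorialAt U x Φ) (hx : x ∈ U)
    {e : Fin n → Π x : M, TangentSpace (𝓡 n) x}
    (he : OrthonormalFrameOn U e) (hX : SmoothFieldOn U X) (hY : SmoothFieldOn U Y)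
    (h : X x = Y x) : Φ X = Φ Y := by
  rw [hΦ.eq_sum he hx hX, hΦ.eq_sum he hx hY, h]

end SmoothTensorialAt

end Tensorial

section Curvature

variable [RiemannianBundle (fun x : M ↦ TangentSpace (𝓡 n) x)]
  [IsContMDiffRiemannianBundle (𝓡 n) ∞ (EuclideanSpace ℝ (Fin n))
    (fun x : M ↦ TangentSpace (𝓡 n) x)]
  {U : Set M} {X X' Y Y' Z Z' : Π x : M, TangentSpace (𝓡 n) x} {x : M} {f : M → ℝ}

theorem SmoothFieldOn.curvatureField (hU : IsOpen U) (hX : SmoothFieldOn U X)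
    (hY : SmoothFieldOn U Y) (hZ : SmoothFieldOn U Z) :
    SmoothFieldOn U (HolomorphicYamabe.curvatureField X Y Z) :=
  ((hX.mlieBracket hY).leviCivita hU hZ).sub
    ((hX.leviCivita hU (hY.leviCivita hU hZ)).sub (hY.leviCivita hU (hX.leviCivita hU hZ)))

theorem leviCivita_congr_left (hX : FieldMDiffAt X x) (hX' : FieldMDiffAt X' x)
    (hY : FieldMDiffAt Y x) (h : X x = X' x) : leviCivita X Y x = leviCivita X' Y x :=
  (tensorialAt_leviCivita hY).pointwise hX hX' h

theorem curvatureField_add_left (hU : IsOpen U) (hx : x ∈ U) (hX : SmoothFieldOn U X)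
    (hX' : SmoothFieldOn U X') (hY : SmoothFieldOn U Y) (hZ : SmoothFieldOn U Z) :
    curvatureField (X + X') Y Z x = curvatureField X Y Z x + curvatureField X' Y Z x := by
  have dX := hX.fieldMDiffAt hx
  have dX' := hX'.fieldMDiffAt hx
  have dY := hY.fieldMDiffAt hx
  have dZ := hZ.fieldMDiffAt hx
  have h1 : leviCivita (VectorField.mlieBracket (𝓡 n) (X + X') Y) Z x =
      leviCivita (VectorField.mlieBracket (𝓡 n) X Y + VectorField.mlieBracket (𝓡 n) X' Y) Z x :=
    leviCivita_congr_left (((hX.add hX').mlieBracket hY).fieldMDiffAt hx)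
      (((hX.mlieBracket hY).add (hX'.mlieBracket hY)).fieldMDiffAt hx) dZ
      (VectorField.mlieBracket_add_left dX dX')
  have h2 : leviCivita Y (leviCivita (X + X') Z) x =
      leviCivita Y (leviCivita X Z + leviCivita X' Z) x :=
    leviCivita_congr_right <| Filter.eventually_of_mem (hU.mem_nhds hx) fun y hy ↦
      leviCivita_add_left (hX.fieldMDiffAt hy) (hX'.fieldMDiffAt hy) (hZ.fieldMDiffAt hy)
  rw [curvatureField, curvatureField, curvatureField, h1, h2,
    leviCivita_add_left ((hX.mlieBracket hY).fieldMDiffAt hx)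
      ((hX'.mlieBracket hY).fieldMDiffAt hx) dZ,
    leviCivita_add_left dX dX' ((hY.leviCivita hU hZ).fieldMDiffAt hx),
    leviCivita_add_right dY ((hX.leviCivita hU hZ).fieldMDiffAt hx)
      ((hX'.leviCivita hU hZ).fieldMDiffAt hx)]
  abel

/-- The term `-(Yf) ∇_X Z` from `[fX, Y]` cancels the Leibniz term of `∇_Y (f ∇_X Z)`. -/
theorem curvatureField_smul_left (hU : IsOpen U) (hx : x ∈ U) (hf : SmoothFunOn n U f)
    (hX : SmoothFieldOn U X) (hY : SmoothFieldOn U Y) (hZ : SmoothFieldOn U Z) :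
    curvatureField (f • X) Y Z x = f x • curvatureField X Y Z x := by
  have dX := hX.fieldMDiffAt hx
  have dY := hY.fieldMDiffAt hx
  have dZ := hZ.fieldMDiffAt hx
  have df := hf.mdifferentiableAt hx
  set h : M → ℝ := fun y ↦ -mvfderiv (𝓡 n) f y (Y y) with hh
  have sh : SmoothFunOn n U h := fun y hy ↦ (SmoothFieldOn.mvfderiv hf hY y hy).neg
  have sB := hX.mlieBracket hY
  have h1 : leviCivita (VectorField.mlieBracket (𝓡 n) (f • X) Y) Z x =
      leviCivita (h • X + f • VectorField.mlieBracket (𝓡 n) X Y) Z x :=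
    leviCivita_congr_left (((SmoothFieldOn.smul hf hX).mlieBracket hY).fieldMDiffAt hx)
      (((SmoothFieldOn.smul sh hX).add (SmoothFieldOn.smul hf sB)).fieldMDiffAt hx) dZ
      (VectorField.mlieBracket_smul_left df dX)
  have h2 : leviCivita Y (leviCivita (f • X) Z) x = leviCivita Y (f • leviCivita X Z) x :=
    leviCivita_congr_right <| Filter.eventually_of_mem (hU.mem_nhds hx) fun y hy ↦
      leviCivita_smul_left (hf.mdifferentiableAt hy) (hX.fieldMDiffAt hy) (hZ.fieldMDiffAt hy)
  rw [curvatureField, curvatureField, h1, h2,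
    leviCivita_add_left ((SmoothFieldOn.smul sh hX).fieldMDiffAt hx)
      ((SmoothFieldOn.smul hf sB).fieldMDiffAt hx) dZ,
    leviCivita_smul_left (sh.mdifferentiableAt hx) dX dZ,
    leviCivita_smul_left df (sB.fieldMDiffAt hx) dZ,
    leviCivita_smul_left df dX ((hY.leviCivita hU hZ).fieldMDiffAt hx),
    leviCivita_smul_right df dY ((hX.leviCivita hU hZ).fieldMDiffAt hx)]
  simp only [hh]
  module

theorem curvatureField_swap (hx : x ∈ U) (hX : SmoothFieldOn U X) (hY : SmoothFieldOn U Y)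
    (hZ : SmoothFieldOn U Z) : curvatureField X Y Z x = -curvatureField Y X Z x := by
  have sB := hY.mlieBracket hX
  have h1 : leviCivita (VectorField.mlieBracket (𝓡 n) X Y) Z x =
      (-1 : ℝ) • leviCivita (VectorField.mlieBracket (𝓡 n) Y X) Z x := by
    rw [← leviCivita_smul_left (f := fun _ ↦ -1) mdifferentiableAt_const (sB.fieldMDiffAt hx)
      (hZ.fieldMDiffAt hx)]
    refine leviCivita_congr_left ((hX.mlieBracket hY).fieldMDiffAt hx)
      ((SmoothFieldOn.smul (fun x _ ↦ contMDiffAt_const) sB).fieldMDiffAt hx)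
      (hZ.fieldMDiffAt hx) ?_
    rw [VectorField.mlieBracket_swap_apply]
    simp
  rw [curvatureField, curvatureField, h1]
  module

theorem curvatureField_add_right (hU : IsOpen U) (hx : x ∈ U) (hX : SmoothFieldOn U X)
    (hY : SmoothFieldOn U Y) (hZ : SmoothFieldOn U Z) (hZ' : SmoothFieldOn U Z') :
    curvatureField X Y (Z + Z') x = curvatureField X Y Z x + curvatureField X Y Z' x := by
  have h1 {W : Π x : M, TangentSpace (𝓡 n) x} (V : Π x : M, TangentSpace (𝓡 n) x)
      (hW : SmoothFieldOn U W) :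
      leviCivita V (leviCivita W (Z + Z')) x = leviCivita V (leviCivita W Z + leviCivita W Z') x :=
    leviCivita_congr_right <| Filter.eventually_of_mem (hU.mem_nhds hx) fun y hy ↦
      leviCivita_add_right (hW.fieldMDiffAt hy) (hZ.fieldMDiffAt hy) (hZ'.fieldMDiffAt hy)
  rw [curvatureField, curvatureField, curvatureField, h1 X hY, h1 Y hX,
    leviCivita_add_right ((hX.mlieBracket hY).fieldMDiffAt hx) (hZ.fieldMDiffAt hx)
      (hZ'.fieldMDiffAt hx),
    leviCivita_add_right (hX.fieldMDiffAt hx) ((hY.leviCivita hU hZ).fieldMDiffAt hx)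
      ((hY.leviCivita hU hZ').fieldMDiffAt hx),
    leviCivita_add_right (hY.fieldMDiffAt hx) ((hX.leviCivita hU hZ).fieldMDiffAt hx)
      ((hX.leviCivita hU hZ').fieldMDiffAt hx)]
  abel

/-- First-order terms are symmetric in `X` and `Y`. The second-order ones give `X(Yf) - Y(Xf)`,
cancelled by the `[X,Y]f` coming from `∇_[X,Y] (fZ)`. -/
theorem curvatureField_smul_right (hU : IsOpen U) (hx : x ∈ U) (hf : SmoothFunOn n U f)
    (hX : SmoothFieldOn U X) (hY : SmoothFieldOn U Y) (hZ : SmoothFieldOn U Z) :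
    curvatureField X Y (f • Z) x = f x • curvatureField X Y Z x := by
  have df := hf.mdifferentiableAt hx
  have dZ := hZ.fieldMDiffAt hx
  have key {V W : Π x : M, TangentSpace (𝓡 n) x} (hV : SmoothFieldOn U V)
      (hW : SmoothFieldOn U W) : leviCivita V (leviCivita W (f • Z)) x =
        f x • leviCivita V (leviCivita W Z) x + mvfderiv (𝓡 n) f x (V x) • leviCivita W Z x +
        (mvfderiv (𝓡 n) f x (W x) • leviCivita V Z x +
        mvfderiv (𝓡 n) (fun y ↦ mvfderiv (𝓡 n) f y (W y)) x (V x) • Z x) := by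
    have sWf := SmoothFieldOn.mvfderiv hf hW
    have sWZ := hW.leviCivita hU hZ
    have dV := hV.fieldMDiffAt hx
    have h1 : leviCivita V (leviCivita W (f • Z)) x =
        leviCivita V (f • leviCivita W Z + (fun y ↦ mvfderiv (𝓡 n) f y (W y)) • Z) x :=
      leviCivita_congr_right <| Filter.eventually_of_mem (hU.mem_nhds hx) fun y hy ↦
        leviCivita_smul_right (hf.mdifferentiableAt hy) (hW.fieldMDiffAt hy) (hZ.fieldMDiffAt hy)
    rw [h1, leviCivita_add_right dV ((SmoothFieldOn.smul hf sWZ).fieldMDiffAt hx)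
        ((SmoothFieldOn.smul sWf hZ).fieldMDiffAt hx),
      leviCivita_smul_right df dV (sWZ.fieldMDiffAt hx),
      leviCivita_smul_right (sWf.mdifferentiableAt hx) dV dZ]
  rw [curvatureField, curvatureField, key hX hY, key hY hX,
    leviCivita_smul_right df ((hX.mlieBracket hY).fieldMDiffAt hx) dZ,
    mvfderiv_mlieBracket_smul hU hx hf hX hY hZ]
  module

theorem tensorialAt_curvatureField_left (hU : IsOpen U) (hx : x ∈ U) (hY : SmoothFieldOn U Y)
    (hZ : SmoothFieldOn U Z) : SmoothTensorialAt U x (fun X ↦ curvatureField X Y Z x) where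
  smul hf hX := curvatureField_smul_left hU hx hf hX hY hZ
  add hX hX' := curvatureField_add_left hU hx hX hX' hY hZ

theorem tensorialAt_curvatureField_middle (hU : IsOpen U) (hx : x ∈ U) (hX : SmoothFieldOn U X)
    (hZ : SmoothFieldOn U Z) : SmoothTensorialAt U x (fun Y ↦ curvatureField X Y Z x) where
  smul {f Y} hf hY := by
    rw [curvatureField_swap hx hX (SmoothFieldOn.smul hf hY) hZ, curvatureField_swap hx hX hY hZ,
      curvatureField_smul_left hU hx hf hY hX hZ, smul_neg]
  add {Y Y'} hY hY' := by
    rw [curvatureField_swap hx hX (hY.add hY') hZ, curvatureField_swap hx hX hY hZ,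
      curvatureField_swap hx hX hY' hZ, curvatureField_add_left hU hx hY hY' hX hZ, neg_add]

theorem tensorialAt_curvatureField_right (hU : IsOpen U) (hx : x ∈ U) (hX : SmoothFieldOn U X)
    (hY : SmoothFieldOn U Y) : SmoothTensorialAt U x (fun Z ↦ curvatureField X Y Z x) where
  smul hf hZ := curvatureField_smul_right hU hx hf hX hY hZ
  add hZ hZ' := curvatureField_add_right hU hx hX hY hZ hZ'

/-- The curvature of vector fields at a point depends only on their values there. -/
theorem curvature_eq_curvatureField (hU : IsOpen U) (hx : x ∈ U) (hX : SmoothFieldOn U X)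
    (hY : SmoothFieldOn U Y) (hZ : SmoothFieldOn U Z) :
    curvature x (X x) (Y x) (Z x) = curvatureField X Y Z x := by
  obtain ⟨V, e, hxV, he⟩ := exists_orthonormalFrameOn (n := n) x
  set t := trivializationAt (EuclideanSpace ℝ (Fin n)) (fun x : M ↦ TangentSpace (𝓡 n) x) x
  set W := U ∩ V ∩ t.baseSet
  have hW : IsOpen W := (hU.inter he.isOpen).inter t.open_baseSet
  have hxW : x ∈ W := ⟨⟨hx, hxV⟩, FiberBundle.mem_baseSet_trivializationAt' x⟩
  have he' := he.mono hW fun y hy ↦ hy.1.2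
  have hX' := hX.mono (U := W) fun y hy ↦ hy.1.1
  have hY' := hY.mono (U := W) fun y hy ↦ hy.1.1
  have hZ' := hZ.mono (U := W) fun y hy ↦ hy.1.1
  have hE (v : TangentSpace (𝓡 n) x) := (SmoothFieldOn.extend v).mono (U := W) fun y hy ↦ hy.2
  -- Replace the extensions by the given fields one slot at a time.
  rw [curvature,
    (tensorialAt_curvatureField_left hW hxW (hE _) (hE _)).pointwise hxW he' (hE _) hX'
      (FiberBundle.extend_apply_self _ _),
    (tensorialAt_curvatureField_middle hW hxW hX' (hE _)).pointwise hxW he' (hE _) hY'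
      (FiberBundle.extend_apply_self _ _),
    (tensorialAt_curvatureField_right hW hxW hX' hY').pointwise hxW he' (hE _) hZ'
      (FiberBundle.extend_apply_self _ _)]

end Curvature

end HolomorphicYamabe

end

/-! ### Basis-independent traces, curvature bounds and dependence of `S_J` on `J` -/

noncomputable section

namespace HolomorphicYamabe

/-- The trace of a bilinear form does not depend on the orthonormal basis. -/
theorem sum_apply_orthonormalBasis_eq {V ι κ : Type*} [NormedAddCommGroup V]
    [InnerProductSpace ℝ V] [Fintype ι] [Fintype κ] (B : V →ₗ[ℝ] V →ₗ[ℝ] ℝ)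
    (b : OrthonormalBasis ι ℝ V) (b' : OrthonormalBasis κ ℝ V) :
    ∑ i, B (b i) (b i) = ∑ k, B (b' k) (b' k) := by
  classical
  have h (i : ι) : B (b i) (b i) =
      ∑ k, ∑ l, (inner ℝ (b' k) (b i) * inner ℝ (b i) (b' l)) * B (b' k) (b' l) := by
    conv_lhs => rw [← b'.sum_repr' (b i)]
    simp only [map_sum, map_smul, LinearMap.sum_apply, LinearMap.smul_apply, smul_eq_mul,
      Finset.mul_sum]
    rw [Finset.sum_comm]
    refine Finset.sum_congr rfl fun k _ ↦ Finset.sum_congr rfl fun l _ ↦ ?_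
    rw [real_inner_comm (b' l) (b i)]
    ring
  simp only [h]
  rw [Finset.sum_comm]
  refine Finset.sum_congr rfl fun k _ ↦ ?_
  rw [Finset.sum_comm]
  simp only [← Finset.sum_mul, b.sum_inner_mul_inner, b'.inner_eq_ite, ite_mul, one_mul, zero_mul]
  simp

variable {n : ℕ} {M : Type*} [TopologicalSpace M] [ChartedSpace (EuclideanSpace ℝ (Fin n)) M]
  [IsManifold (𝓡 n) ∞ M] [RiemannianBundle (fun x : M ↦ TangentSpace (𝓡 n) x)]

namespace CompatibleACS

variable (J J' : CompatibleACS n M) {U : Set M} {x : M}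

theorem smoothFieldOn_apply {X : Π x : M, TangentSpace (𝓡 n) x} (hX : SmoothFieldOn U X) :
    SmoothFieldOn U fun x ↦ J.J x (X x) :=
  fun x hx ↦ (J.smooth x).clm_bundle_apply (hX x hx)

/-- An isometry with square `-1` is skew. This puts the `*`-scalar curvature in the form `∑
g(R(eᵢ,eⱼ)Jeᵢ, Jeⱼ)`. -/
theorem inner_neg_apply_left (v w : TangentSpace (𝓡 n) x) :
    (inner ℝ (-(J.J x v)) w : ℝ) = inner ℝ v (J.J x w) := by
  rw [inner_neg_left, ← J.compat x (J.J x v) w, J.sq, inner_neg_left, neg_neg]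

theorem norm_sub_apply_onb_le_pointDist
    (i : Fin (Module.finrank ℝ (TangentSpace (𝓡 n) x))) :
    ‖J.J x (onb x i) - J'.J x (onb x i)‖ ≤ pointDist J J' x :=
  Real.le_sqrt_of_sq_le (Finset.single_le_sum
    (f := fun i ↦ ‖J.J x (onb x i) - J'.J x (onb x i)‖ ^ 2) (fun _ _ ↦ sq_nonneg _)
    (Finset.mem_univ i))

end CompatibleACS

variable [IsContMDiffRiemannianBundle (𝓡 n) ∞ (EuclideanSpace ℝ (Fin n))
    (fun x : M ↦ TangentSpace (𝓡 n) x)]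

section CurvatureTensor

variable {x : M}

/-- The sum of the extensions of `v` and `v'` takes the value `v + v'` at `x`, so it computes the
same curvature as the extension of `v + v'`. -/
theorem isLinearMap_curvature_left (w z : TangentSpace (𝓡 n) x) :
    IsLinearMap ℝ (fun v ↦ curvature x v w z) := by
  set t := trivializationAt (EuclideanSpace ℝ (Fin n)) (fun x : M ↦ TangentSpace (𝓡 n) x) x
  have hx : x ∈ t.baseSet := FiberBundle.mem_baseSet_trivializationAt' x
  have hT := tensorialAt_curvatureField_left t.open_baseSet hx (.extend w) (.extend z)
  have hE (v : TangentSpace (𝓡 n) x) := SmoothFieldOn.extend v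
  refine ⟨fun v v' ↦ ?_, fun c v ↦ ?_⟩
  · have h := curvature_eq_curvatureField t.open_baseSet hx ((hE v).add (hE v')) (hE w) (hE z)
    rw [hT.add (hE v) (hE v')] at h
    simpa [curvature] using h
  · have hc : SmoothFunOn n t.baseSet fun _ ↦ c := fun _ _ ↦ contMDiffAt_const
    have h := curvature_eq_curvatureField t.open_baseSet hx (.smul hc (hE v)) (hE w) (hE z)
    rw [hT.smul hc (hE v)] at h
    simpa [curvature] using h

theorem isLinearMap_curvature_middle (v z : TangentSpace (𝓡 n) x) :
    IsLinearMap ℝ (fun w ↦ curvature x v w z) := by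
  set t := trivializationAt (EuclideanSpace ℝ (Fin n)) (fun x : M ↦ TangentSpace (𝓡 n) x) x
  have hx : x ∈ t.baseSet := FiberBundle.mem_baseSet_trivializationAt' x
  have hT := tensorialAt_curvatureField_middle t.open_baseSet hx (.extend v) (.extend z)
  have hE (v : TangentSpace (𝓡 n) x) := SmoothFieldOn.extend v
  refine ⟨fun w w' ↦ ?_, fun c w ↦ ?_⟩
  · have h := curvature_eq_curvatureField t.open_baseSet hx (hE v) ((hE w).add (hE w')) (hE z)
    rw [hT.add (hE w) (hE w')] at h
    simpa [curvature] using h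
  · have hc : SmoothFunOn n t.baseSet fun _ ↦ c := fun _ _ ↦ contMDiffAt_const
    have h := curvature_eq_curvatureField t.open_baseSet hx (hE v) (.smul hc (hE w)) (hE z)
    rw [hT.smul hc (hE w)] at h
    simpa [curvature] using h

theorem isLinearMap_curvature_right (v w : TangentSpace (𝓡 n) x) :
    IsLinearMap ℝ (fun z ↦ curvature x v w z) := by
  set t := trivializationAt (EuclideanSpace ℝ (Fin n)) (fun x : M ↦ TangentSpace (𝓡 n) x) x
  have hx : x ∈ t.baseSet := FiberBundle.mem_baseSet_trivializationAt' x
  have hT := tensorialAt_curvatureField_right t.open_baseSet hx (.extend v) (.extend w)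
  have hE (v : TangentSpace (𝓡 n) x) := SmoothFieldOn.extend v
  refine ⟨fun z z' ↦ ?_, fun c z ↦ ?_⟩
  · have h := curvature_eq_curvatureField t.open_baseSet hx (hE v) (hE w) ((hE z).add (hE z'))
    rw [hT.add (hE z) (hE z')] at h
    simpa [curvature] using h
  · have hc : SmoothFunOn n t.baseSet fun _ ↦ c := fun _ _ ↦ contMDiffAt_const
    have h := curvature_eq_curvatureField t.open_baseSet hx (hE v) (hE w) (.smul hc (hE z))
    rw [hT.smul hc (hE z)] at h
    simpa [curvature] using h

/-- The contraction `∑ g(A (R(eᵢ, eⱼ)(B eᵢ)), eⱼ)` of the curvature tensor does not depend on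
the orthonormal basis. -/
theorem sum_curvature_orthonormalBasis_eq {ι κ : Type*} [Fintype ι] [Fintype κ]
    (A B : TangentSpace (𝓡 n) x →ₗ[ℝ] TangentSpace (𝓡 n) x)
    (b : OrthonormalBasis ι ℝ (TangentSpace (𝓡 n) x))
    (b' : OrthonormalBasis κ ℝ (TangentSpace (𝓡 n) x)) :
    ∑ i, ∑ j, (inner ℝ (A (curvature x (b i) (b j) (B (b i)))) (b j) : ℝ) =
      ∑ i, ∑ j, (inner ℝ (A (curvature x (b' i) (b' j) (B (b' i)))) (b' j) : ℝ) := by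
  have hl := isLinearMap_curvature_left (n := n) (x := x)
  have hm := isLinearMap_curvature_middle (n := n) (x := x)
  have hr := isLinearMap_curvature_right (n := n) (x := x)
  have h1 (v z : TangentSpace (𝓡 n) x) :
      ∑ j, (inner ℝ (A (curvature x v (b j) z)) (b j) : ℝ) =
        ∑ j, (inner ℝ (A (curvature x v (b' j) z)) (b' j) : ℝ) :=
    sum_apply_orthonormalBasis_eq (LinearMap.mk₂ ℝ
      (fun w w' ↦ (inner ℝ (A (curvature x v w z)) w' : ℝ))
      (fun w₁ w₂ w' ↦ by rw [(hm v z).map_add, map_add, inner_add_left])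
      (fun c w w' ↦ by rw [(hm v z).map_smul, map_smul, real_inner_smul_left, smul_eq_mul])
      (fun w w₁ w₂ ↦ inner_add_right _ _ _)
      (fun c w w' ↦ real_inner_smul_right _ _ _)) b b'
  -- With the inner trace moved to `b'`, the outer sum is again the trace of a bilinear form.
  simp only [h1]
  exact sum_apply_orthonormalBasis_eq (LinearMap.mk₂ ℝ
      (fun v v' ↦ ∑ j, (inner ℝ (A (curvature x v (b' j) (B v'))) (b' j) : ℝ))
      (fun v₁ v₂ v' ↦ by
        simp only [(hl _ _).map_add, map_add, inner_add_left, Finset.sum_add_distrib])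
      (fun c v v' ↦ by
        simp only [(hl _ _).map_smul, map_smul, real_inner_smul_left, Finset.mul_sum, smul_eq_mul])
      (fun v v₁ v₂ ↦ by
        simp only [map_add, (hr _ _).map_add, inner_add_left, Finset.sum_add_distrib])
      (fun c v v' ↦ by
        simp only [map_smul, (hr _ _).map_smul, real_inner_smul_left, Finset.mul_sum,
          smul_eq_mul])) b b'

/-- Expand all three arguments in the basis and bound each coefficient by Cauchy–Schwarz. -/
theorem norm_curvature_le_of_orthonormalBasis {ι : Type*} [Fintype ι]
    (b : OrthonormalBasis ι ℝ (TangentSpace (𝓡 n) x)) (v w z : TangentSpace (𝓡 n) x) :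
    ‖curvature x v w z‖ ≤
      (∑ i, ∑ j, ∑ k, ‖curvature x (b i) (b j) (b k)‖) * (‖v‖ * ‖w‖ * ‖z‖) := by
  have hb (i) (u : TangentSpace (𝓡 n) x) : ‖(inner ℝ (b i) u : ℝ)‖ ≤ ‖u‖ := by
    have := norm_inner_le_norm (𝕜 := ℝ) (b i) u
    rwa [b.norm_eq_one, one_mul] at this
  have h (v w z : TangentSpace (𝓡 n) x) : curvature x v w z = ∑ i, ∑ j, ∑ k,
      (inner ℝ (b i) v * inner ℝ (b j) w * inner ℝ (b k) z : ℝ) •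
        curvature x (b i) (b j) (b k) := by
    have e1 : curvature x v w z = ∑ i, (inner ℝ (b i) v : ℝ) • curvature x (b i) w z := by
      conv_lhs => rw [← b.sum_repr' v]
      exact (map_sum ((isLinearMap_curvature_left w z).mk' _) _ _).trans
        (Finset.sum_congr rfl fun i _ ↦ (isLinearMap_curvature_left w z).map_smul _ _)
    have e2 (i) : curvature x (b i) w z =
        ∑ j, (inner ℝ (b j) w : ℝ) • curvature x (b i) (b j) z := by
      conv_lhs => rw [← b.sum_repr' w]
      exact (map_sum ((isLinearMap_curvature_middle (b i) z).mk' _) _ _).trans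
        (Finset.sum_congr rfl fun j _ ↦ (isLinearMap_curvature_middle (b i) z).map_smul _ _)
    have e3 (i j) : curvature x (b i) (b j) z =
        ∑ k, (inner ℝ (b k) z : ℝ) • curvature x (b i) (b j) (b k) := by
      conv_lhs => rw [← b.sum_repr' z]
      exact (map_sum ((isLinearMap_curvature_right (b i) (b j)).mk' _) _ _).trans
        (Finset.sum_congr rfl fun k _ ↦ (isLinearMap_curvature_right (b i) (b j)).map_smul _ _)
    simp only [e1, e2, e3, Finset.smul_sum, smul_smul, mul_assoc]
  rw [h]
  simp only [Finset.sum_mul]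
  refine norm_sum_le_of_le _ fun i _ ↦ norm_sum_le_of_le _ fun j _ ↦
    norm_sum_le_of_le _ fun k _ ↦ ?_
  rw [norm_smul, norm_mul, norm_mul, mul_comm]
  gcongr <;> exact hb _ _

end CurvatureTensor

section Bounds

/-- In a smooth frame the sum of the norms of the curvature components is continuous, so it stays
below its value at `x₀` plus 1. -/
theorem exists_curvature_bound_nhds (x₀ : M) : ∃ K : ℝ, ∀ᶠ x in 𝓝 x₀,
    ∀ v w z : TangentSpace (𝓡 n) x, ‖curvature x v w z‖ ≤ K * (‖v‖ * ‖w‖ * ‖z‖) := by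
  obtain ⟨U, e, hx, he⟩ := exists_orthonormalFrameOn (n := n) x₀
  let F (x : M) : ℝ := ∑ i, ∑ j, ∑ k, ‖curvatureField (e i) (e j) (e k) x‖
  have hF : ContinuousAt F x₀ := by
    refine tendsto_finsetSum _ fun i _ ↦ tendsto_finsetSum _ fun j _ ↦
      tendsto_finsetSum _ fun k _ ↦ ?_
    have h := (he.smooth i).curvatureField he.isOpen (he.smooth j) (he.smooth k)
    simp only [norm_eq_sqrt_real_inner]
    exact ((h.inner h).continuousOn.continuousAt (he.isOpen.mem_nhds hx)).sqrt
  refine ⟨F x₀ + 1, ?_⟩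
  filter_upwards [he.isOpen.mem_nhds hx, hF.eventually_le_const (lt_add_one (F x₀))]
    with x hxU hxF v w z
  refine (norm_curvature_le_of_orthonormalBasis (he.basis hxU) v w z).trans ?_
  gcongr
  simp only [OrthonormalFrameOn.basis_apply]
  refine le_trans (le_of_eq ?_) hxF
  refine Finset.sum_congr rfl fun i _ ↦ Finset.sum_congr rfl fun j _ ↦
    Finset.sum_congr rfl fun k _ ↦ ?_
  rw [curvature_eq_curvatureField he.isOpen hxU (he.smooth i) (he.smooth j) (he.smooth k)]

variable (n M) in
theorem exists_curvature_bound [CompactSpace M] : ∃ K : ℝ, 0 ≤ K ∧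
    ∀ (x : M) (v w z : TangentSpace (𝓡 n) x), ‖curvature x v w z‖ ≤ K * (‖v‖ * ‖w‖ * ‖z‖) := by
  choose K hK using exists_curvature_bound_nhds (n := n) (M := M)
  obtain ⟨t, -, ht⟩ := isCompact_univ.elim_nhds_subcover _ fun x _ ↦ hK x
  -- The sum of absolute values dominates each local constant of the finite subcover and is
  -- nonnegative.
  refine ⟨∑ y ∈ t, |K y|, Finset.sum_nonneg fun y _ ↦ abs_nonneg _, fun x v w z ↦ ?_⟩
  obtain ⟨y, hy, hxy⟩ := Set.mem_iUnion₂.1 (ht (Set.mem_univ x))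
  refine (hxy v w z).trans ?_
  gcongr
  exact (le_abs_self _).trans
    (Finset.single_le_sum (f := fun y ↦ |K y|) (fun y _ ↦ abs_nonneg _) hy)

end Bounds

namespace CompatibleACS

variable (J J' : CompatibleACS n M) {U : Set M} {x : M}

/-- Both traces are moved from `onb x` to the frame, where they are polynomial in smooth data. -/
theorem smoothFunOn_holomorphicDScalar {e : Fin n → Π x : M, TangentSpace (𝓡 n) x}
    (he : OrthonormalFrameOn U e) : SmoothFunOn n U J.holomorphicDScalar := by
  have hJ (i) := J.smoothFieldOn_apply (he.smooth i)
  have h1 : SmoothFunOn n U fun x ↦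
      ∑ i, ∑ j, (inner ℝ (curvatureField (e i) (e j) (e i) x) (e j x) : ℝ) :=
    .sum fun i _ ↦ .sum fun j _ ↦ ((he.smooth i).curvatureField he.isOpen (he.smooth j)
      (he.smooth i)).inner (he.smooth j)
  have h2 : SmoothFunOn n U fun x ↦ ∑ i, ∑ j, (inner ℝ
      (curvatureField (e i) (e j) (fun y ↦ J.J y (e i y)) x) (J.J x (e j x)) : ℝ) :=
    .sum fun i _ ↦ .sum fun j _ ↦ ((he.smooth i).curvatureField he.isOpen (he.smooth j)
      (hJ i)).inner (hJ j)
  refine (h1.sub h2).congr he.isOpen fun x hx ↦ ?_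
  have e1 := sum_curvature_orthonormalBasis_eq LinearMap.id LinearMap.id (onb x) (he.basis hx)
  have e2 := sum_curvature_orthonormalBasis_eq (-(J.J x).toLinearMap) (J.J x).toLinearMap
    (onb x) (he.basis hx)
  simp only [LinearMap.id_apply, OrthonormalFrameOn.basis_apply] at e1
  simp only [LinearMap.neg_apply, ContinuousLinearMap.coe_coe,
    OrthonormalFrameOn.basis_apply, J.inner_neg_apply_left] at e2
  simp only [holomorphicDScalar, scalarCurvature, ricci, starScalarCurvature, starRicci,
    J.inner_neg_apply_left, e1, e2]
  congr 1 <;> refine Finset.sum_congr rfl fun i _ ↦ Finset.sum_congr rfl fun j _ ↦ ?_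
  · rw [curvature_eq_curvatureField he.isOpen hx (he.smooth i) (he.smooth j) (he.smooth i)]
  · rw [← curvature_eq_curvatureField he.isOpen hx (he.smooth i) (he.smooth j) (hJ i)]

theorem continuous_holomorphicDScalar : Continuous J.holomorphicDScalar := by
  rw [continuous_iff_continuousAt]
  intro x
  obtain ⟨U, e, hx, he⟩ := exists_orthonormalFrameOn (n := n) x
  exact (J.smoothFunOn_holomorphicDScalar he).continuousOn.continuousAt (he.isOpen.mem_nhds hx)

/-- The scalar curvature cancels. The difference of the quadratic terms splits into one term with `J
- J'` in the curvature slot and one with it in the other factor; each is at most `K d(J,J')`, and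
there are `n²` index pairs. -/
theorem abs_holomorphicDScalar_sub_le {K : ℝ} (hK0 : 0 ≤ K)
    (hK : ∀ v w z : TangentSpace (𝓡 n) x, ‖curvature x v w z‖ ≤ K * (‖v‖ * ‖w‖ * ‖z‖)) :
    |J.holomorphicDScalar x - J'.holomorphicDScalar x| ≤ n * (n * (2 * K)) * dist J J' := by
  have hlin (i j) := isLinearMap_curvature_right (onb (n := n) x i) (onb x j)
  have hd (i) : ‖J.J x (onb x i) - J'.J x (onb x i)‖ ≤ dist J J' :=
    (norm_sub_apply_onb_le_pointDist J J' i).trans (pointDist_le_c0Dist J J' x)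
  have hterm (i j) : |(inner ℝ (curvature x (onb x i) (onb x j) (J'.J x (onb x i)))
      (J'.J x (onb x j)) : ℝ) - inner ℝ (curvature x (onb x i) (onb x j) (J.J x (onb x i)))
      (J.J x (onb x j))| ≤ 2 * K * dist J J' := by
    have e : (inner ℝ (curvature x (onb x i) (onb x j) (J'.J x (onb x i)))
      (J'.J x (onb x j)) : ℝ) - inner ℝ (curvature x (onb x i) (onb x j) (J.J x (onb x i)))
      (J.J x (onb x j)) =
        -(inner ℝ (curvature x (onb x i) (onb x j) (J.J x (onb x i) - J'.J x (onb x i)))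
          (J.J x (onb x j)) + inner ℝ (curvature x (onb x i) (onb x j) (J'.J x (onb x i)))
          (J.J x (onb x j) - J'.J x (onb x j))) := by
      rw [(hlin i j).map_sub, inner_sub_left, inner_sub_right]
      ring
    rw [e, abs_neg]
    have b1 := (norm_inner_le_norm (𝕜 := ℝ)
      (curvature x (onb x i) (onb x j) (J.J x (onb x i) - J'.J x (onb x i)))
      (J.J x (onb x j))).trans (mul_le_mul_of_nonneg_right (hK _ _ _) (norm_nonneg _))
    have b2 := (norm_inner_le_norm (𝕜 := ℝ) (curvature x (onb x i) (onb x j) (J'.J x (onb x i)))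
      (J.J x (onb x j) - J'.J x (onb x j))).trans
        (mul_le_mul_of_nonneg_right (hK _ _ _) (norm_nonneg _))
    simp only [norm_apply, (onb x).norm_eq_one, one_mul, mul_one] at b1 b2
    refine (abs_add_le _ _).trans ((add_le_add b1 b2).trans ?_)
    nlinarith [mul_le_mul_of_nonneg_left (hd i) hK0, mul_le_mul_of_nonneg_left (hd j) hK0]
  have e : J.holomorphicDScalar x - J'.holomorphicDScalar x =
      ∑ i, ∑ j, ((inner ℝ (curvature x (onb x i) (onb x j) (J'.J x (onb x i)))
      (J'.J x (onb x j)) : ℝ) - inner ℝ (curvature x (onb x i) (onb x j) (J.J x (onb x i)))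
      (J.J x (onb x j))) := by
    simp only [holomorphicDScalar, starScalarCurvature, starRicci, inner_neg_apply_left,
      Finset.sum_sub_distrib]
    ring
  rw [e, ← Real.norm_eq_abs]
  refine (norm_sum_le_of_le _ fun i _ ↦ norm_sum_le_of_le _ fun j _ ↦ hterm i j).trans
    (le_of_eq ?_)
  rw [Finset.sum_const, Finset.sum_const, Finset.card_univ, Fintype.card_fin, finrank_tangentSpace]
  simp only [nsmul_eq_mul]
  ring

end CompatibleACS

theorem continuous_normSqDifferential {u : M → ℝ} (hu : ContMDiff (𝓡 n) 𝓘(ℝ, ℝ) ∞ u) :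
    Continuous (normSqDifferential n u) := by
  rw [continuous_iff_continuousAt]
  intro x₀
  obtain ⟨U, e, hx₀, he⟩ := exists_orthonormalFrameOn (n := n) x₀
  have hu' : SmoothFunOn n U u := fun x _ ↦ hu x
  have h (i) := SmoothFieldOn.mvfderiv hu' (he.smooth i)
  have hs : SmoothFunOn n U fun x ↦
      ∑ i, mvfderiv (𝓡 n) u x (e i x) * mvfderiv (𝓡 n) u x (e i x) :=
    .sum fun i _ ↦ (h i).mul (h i)
  refine (hs.congr he.isOpen fun x hx ↦ ?_).continuousOn.continuousAt (he.isOpen.mem_nhds hx₀)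
  have ht := sum_apply_orthonormalBasis_eq ((LinearMap.mul ℝ ℝ).compl₁₂
    (mvfderiv (𝓡 n) u x).toLinearMap (mvfderiv (𝓡 n) u x).toLinearMap) (onb x) (he.basis hx)
  simpa [normSqDifferential, sq] using ht

end HolomorphicYamabe

end

/-! ### Finiteness of the volume and integrability -/

noncomputable section

namespace HolomorphicYamabe

variable {n : ℕ} {M : Type*} [TopologicalSpace M] [ChartedSpace (EuclideanSpace ℝ (Fin n)) M]
  [IsManifold (𝓡 n) ∞ M] [RiemannianBundle (fun x : M ↦ TangentSpace (𝓡 n) x)]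
  [IsContMDiffRiemannianBundle (𝓡 n) ∞ (EuclideanSpace ℝ (Fin n))
    (fun x : M ↦ TangentSpace (𝓡 n) x)]

theorem continuousOn_chartDensity (c : M) :
    ContinuousOn (chartDensity (n := n) c) (extChartAt (𝓡 n) c).target := by
  set t := trivializationAt (EuclideanSpace ℝ (Fin n)) (fun x : M ↦ TangentSpace (𝓡 n) x) c
  let s (i : Fin n) (x : M) : TangentSpace (𝓡 n) x := t.symm x (EuclideanSpace.single i 1)
  have hs (i) : SmoothFieldOn t.baseSet (s i) := by
    intro x hx
    rw [t.contMDiffAt_section_iff hx]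
    refine (contMDiffAt_const (c := EuclideanSpace.single i (1 : ℝ))).congr_of_eventuallyEq <|
      Filter.eventually_of_mem (t.open_baseSet.mem_nhds hx) fun z hz ↦ ?_
    have h := congrArg Prod.snd (t.apply_mk_symm hz (EuclideanSpace.single i (1 : ℝ)))
    exact h
  have hmaps : Set.MapsTo (extChartAt (𝓡 n) c).symm (extChartAt (𝓡 n) c).target t.baseSet := by
    intro y hy
    have := (extChartAt (𝓡 n) c).map_target hy
    rwa [extChartAt_source] at this
  have hentry (i j : Fin n) : ContinuousOn (fun y ↦ (inner ℝ
      (mfderiv (𝓡 n) (𝓡 n) (extChartAt (𝓡 n) c).symm y (EuclideanSpace.single i (1 : ℝ)) :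
        TangentSpace (𝓡 n) ((extChartAt (𝓡 n) c).symm y))
      (mfderiv (𝓡 n) (𝓡 n) (extChartAt (𝓡 n) c).symm y (EuclideanSpace.single j (1 : ℝ)) :
        TangentSpace (𝓡 n) ((extChartAt (𝓡 n) c).symm y)) : ℝ)) (extChartAt (𝓡 n) c).target := by
    refine (((hs i).inner (hs j)).continuousOn.comp (continuousOn_extChartAt_symm c)
      hmaps).congr fun y hy ↦ ?_
    -- The coordinate fields are the constant sections of the tangent trivialization at `c`, so the
    -- Gram matrix has continuous entries.
    have key (k : Fin n) : (mfderiv (𝓡 n) (𝓡 n) (extChartAt (𝓡 n) c).symm y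
        (EuclideanSpace.single k (1 : ℝ)) : TangentSpace (𝓡 n) ((extChartAt (𝓡 n) c).symm y)) =
        s k ((extChartAt (𝓡 n) c).symm y) := by
      have h := TangentBundle.symmL_trivializationAt (I := 𝓡 n) (hmaps hy)
      rw [(extChartAt (𝓡 n) c).right_inv hy] at h
      have h' := congrArg (fun L ↦ L (EuclideanSpace.single k (1 : ℝ))) h
      simp only [modelWithCornersSelf_coe, Set.range_id, mfderivWithin_univ] at h'
      exact h'.symm.trans (t.symmL_apply (hmaps hy) _)
    simp only [key, Function.comp]
  exact ((continuous_id.matrix_det).comp_continuousOn (continuousOn_pi.2 fun i ↦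
    continuousOn_pi.2 fun j ↦ hentry i j)).sqrt

variable [T2Space M] [CompactSpace M] [MeasurableSpace M] [BorelSpace M]

/-- By compactness only finitely many partition functions are nonzero. Each contributes a density
that is continuous on the chart target and vanishes off a compact subset of it. -/
instance isFiniteMeasure_riemannianVolume : IsFiniteMeasure (riemannianVolume n M) := by
  have hfin := (chartPartition n M).locallyFinite.finite_nonempty_of_compact
  have hpiece (c : M) : IsFiniteMeasure (((volume : Measure (EuclideanSpace ℝ (Fin n))).restrict
      (extChartAt (𝓡 n) c).target).withDensity fun y ↦ ENNReal.ofReal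
        (chartPartition n M c ((extChartAt (𝓡 n) c).symm y) * chartDensity c y)) := by
    refine isFiniteMeasure_withDensity_ofReal (Integrable.hasFiniteIntegral ?_)
    set φ := extChartAt (𝓡 n) c
    have hsub : tsupport (chartPartition n M c) ⊆ φ.source := by
      rw [extChartAt_source]
      exact chartPartition_isSubordinate c
    have hK : IsCompact (φ '' tsupport (chartPartition n M c)) :=
      (isClosed_tsupport _).isCompact.image_of_continuousOn
        ((continuousOn_extChartAt c).mono hsub)
    have hKsub : φ '' tsupport (chartPartition n M c) ⊆ φ.target := by
      rintro _ ⟨x, hx, rfl⟩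
      exact φ.map_source (hsub hx)
    have hcont : ContinuousOn (fun y ↦ chartPartition n M c (φ.symm y) * chartDensity c y)
        φ.target :=
      ((chartPartition n M c).contMDiff.continuous.comp_continuousOn
        (continuousOn_extChartAt_symm c)).mul (continuousOn_chartDensity c)
    refine ((hcont.mono hKsub).integrableOn_compact hK).of_forall_sdiff_eq_zero
      (isOpen_extChartAt_target c).measurableSet fun y hy ↦ ?_
    have : chartPartition n M c (φ.symm y) = 0 := by
      by_contra h
      exact hy.2 ⟨φ.symm y, subset_tsupport _ h, φ.right_inv hy.1⟩
    rw [this, zero_mul]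
  refine ⟨?_⟩
  rw [riemannianVolume, Measure.sum_apply _ MeasurableSet.univ,
    tsum_eq_sum (s := hfin.toFinset) fun c hc ↦ ?_]
  · refine ENNReal.sum_lt_top.2 fun c _ ↦ ?_
    have := hpiece c
    exact measure_lt_top _ _
  · have h0 (x : M) : chartPartition n M c x = 0 := by
      by_contra h
      exact hc (hfin.mem_toFinset.2 ⟨x, h⟩)
    simp [h0]

theorem CompatibleACS.integrable_integrand (J : CompatibleACS n M) {u : M → ℝ}
    (hu : ContMDiff (𝓡 n) 𝓘(ℝ, ℝ) ∞ u) :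
    Integrable (fun x ↦ 4 * normSqDifferential n u x + J.holomorphicDScalar x * u x ^ 2)
      (riemannianVolume n M) := by
  have hc := ((continuous_normSqDifferential hu).const_mul 4).add
    (J.continuous_holomorphicDScalar.mul (hu.continuous.pow 2))
  exact hc.integrable_of_hasCompactSupport (.of_compactSpace _)

end HolomorphicYamabe

end

/-! ### Hölder estimate and Lipschitz dependence of `Y` on `J` -/

noncomputable section

namespace HolomorphicYamabe

variable {n : ℕ} {M : Type*} [TopologicalSpace M] [ChartedSpace (EuclideanSpace ℝ (Fin n)) M]
  [IsManifold (𝓡 n) ∞ M] [RiemannianBundle (fun x : M ↦ TangentSpace (𝓡 n) x)]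
  [T2Space M] [CompactSpace M] [MeasurableSpace M]

theorem CompatibleACS.nonempty_QValues (J : CompatibleACS n M) : J.QValues.Nonempty :=
  ⟨_, fun _ ↦ 1, contMDiff_const, fun _ ↦ one_pos, rfl⟩

variable [IsContMDiffRiemannianBundle (𝓡 n) ∞ (EuclideanSpace ℝ (Fin n))
  (fun x : M ↦ TangentSpace (𝓡 n) x)] [BorelSpace M]

/-- Hölder's inequality on a closed Riemannian manifold, for the critical Sobolev exponent. -/
theorem integral_sq_le_lpNorm_sq (hn : 2 < n) {u : M → ℝ} (hu : Continuous u) :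
    ∫ x, u x ^ 2 ∂riemannianVolume n M ≤
      lpNorm n (2 * n / (n - 2)) u ^ 2 * (riemannianVolume n M).real Set.univ ^ (2 / n : ℝ) := by
  have hn' : (2 : ℝ) < n := by exact_mod_cast hn
  have hn0 : (0 : ℝ) < n - 2 := by linarith
  -- Hölder is applied to `u² · 1` with exponents `p/2 = n/(n-2)` and its conjugate `n/2`; the
  -- latter yields `Vol^(2/n)`.
  have hconj : ((n : ℝ) / (n - 2)).HolderConjugate (n / 2) := by
    rw [Real.holderConjugate_iff]
    refine ⟨by rw [lt_div_iff₀ hn0]; linarith, ?_⟩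
    field_simp
    ring
  have h := integral_mul_le_Lp_mul_Lq_of_nonneg (μ := riemannianVolume n M) hconj
    (f := fun x ↦ u x ^ 2) (g := fun _ ↦ (1 : ℝ)) (.of_forall fun x ↦ sq_nonneg _)
    (.of_forall fun x ↦ zero_le_one)
    ((hu.pow 2).memLp_of_hasCompactSupport (.of_compactSpace _)) (memLp_const 1)
  have hpow (x : M) : (u x ^ 2) ^ ((n : ℝ) / (n - 2)) = |u x| ^ (2 * (n : ℝ) / (n - 2)) := by
    rw [← sq_abs, ← Real.rpow_natCast, ← Real.rpow_mul (abs_nonneg _)]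
    congr 1
    push_cast
    ring
  have hlp : (∫ x, |u x| ^ (2 * (n : ℝ) / (n - 2)) ∂riemannianVolume n M) ^
      (1 / ((n : ℝ) / (n - 2))) = lpNorm n (2 * n / (n - 2)) u ^ 2 := by
    rw [lpNorm, ← Real.rpow_natCast, ← Real.rpow_mul
      (integral_nonneg fun x ↦ Real.rpow_nonneg (abs_nonneg _) _)]
    congr 1
    push_cast
    field_simp
  simp only [mul_one, hpow, Real.one_rpow, hlp, integral_const, smul_eq_mul] at h
  convert h using 3
  field_simp

namespace CompatibleACS

theorem exists_abs_Q_sub_le (hn : 2 < n) : ∃ L : ℝ, 0 ≤ L ∧ ∀ (J J' : CompatibleACS n M)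
    (u : M → ℝ), ContMDiff (𝓡 n) 𝓘(ℝ, ℝ) ∞ u → |J.Q u - J'.Q u| ≤ L * dist J J' := by
  obtain ⟨K, hK0, hK⟩ := exists_curvature_bound n M
  set V := (riemannianVolume n M).real Set.univ ^ (2 / n : ℝ)
  have hV : 0 ≤ V := Real.rpow_nonneg measureReal_nonneg _
  refine ⟨n * (n * (2 * K)) * V, by positivity, fun J J' u hu ↦ ?_⟩
  have hd : 0 ≤ dist J J' := dist_nonneg
  have hS := (J.continuous_holomorphicDScalar.sub J'.continuous_holomorphicDScalar)
  have hu2 := hu.continuous.pow 2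
  have hbound : |∫ x, (J.holomorphicDScalar x - J'.holomorphicDScalar x) * u x ^ 2
      ∂riemannianVolume n M| ≤
      n * (n * (2 * K)) * dist J J' * ∫ x, u x ^ 2 ∂riemannianVolume n M := by
    rw [← integral_const_mul, ← Real.norm_eq_abs]
    refine norm_integral_le_of_norm_le
      ((hu2.const_mul _).integrable_of_hasCompactSupport (.of_compactSpace _))
      (.of_forall fun x ↦ ?_)
    rw [norm_mul, Real.norm_eq_abs, Real.norm_of_nonneg (sq_nonneg (u x))]
    gcongr
    exact J.abs_holomorphicDScalar_sub_le J' hK0 (hK x)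
  have hdiff : J.Q u - J'.Q u = (∫ x, (J.holomorphicDScalar x - J'.holomorphicDScalar x) * u x ^ 2
      ∂riemannianVolume n M) / lpNorm n (2 * n / (n - 2)) u ^ 2 := by
    rw [Q, Q, ← sub_div, ← integral_sub (J.integrable_integrand hu) (J'.integrable_integrand hu)]
    congr 2
    ext x
    ring
  rw [hdiff, abs_div, abs_of_nonneg (sq_nonneg (lpNorm n (2 * n / (n - 2)) u))]
  -- This form also covers a zero denominator, so positivity of `‖u‖_p` is not needed.
  refine div_le_of_le_mul₀ (sq_nonneg _) (by positivity) (hbound.trans ?_)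
  refine (mul_le_mul_of_nonneg_left (integral_sq_le_lpNorm_sq hn hu.continuous)
    (by positivity)).trans (le_of_eq ?_)
  ring

/-- Drop the nonnegative gradient term, bound `S_J` below by compactness and apply Hölder to `∫u²`.
-/
theorem exists_le_Q (hn : 2 < n) (J : CompatibleACS n M) :
    ∃ C : ℝ, ∀ u : M → ℝ, ContMDiff (𝓡 n) 𝓘(ℝ, ℝ) ∞ u → C ≤ J.Q u := by
  obtain ⟨B, hB⟩ := (isCompact_range J.continuous_holomorphicDScalar).bddBelow
  set V := (riemannianVolume n M).real Set.univ ^ (2 / n : ℝ)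
  have hV : 0 ≤ V := Real.rpow_nonneg measureReal_nonneg _
  refine ⟨-(|B| * V), fun u hu ↦ ?_⟩
  have hu2 := hu.continuous.pow 2
  have h1 : -(|B| * ∫ x, u x ^ 2 ∂riemannianVolume n M) ≤
      ∫ x, (4 * normSqDifferential n u x + J.holomorphicDScalar x * u x ^ 2)
        ∂riemannianVolume n M := by
    rw [← integral_const_mul, ← integral_neg]
    refine integral_mono
      ((hu2.const_mul _).neg.integrable_of_hasCompactSupport (.of_compactSpace _))
      (J.integrable_integrand hu) fun x ↦ ?_
    have h2 : 0 ≤ normSqDifferential n u x := Finset.sum_nonneg fun i _ ↦ sq_nonneg _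
    have h3 : -|B| ≤ J.holomorphicDScalar x := (neg_abs_le B).trans (hB ⟨x, rfl⟩)
    have h4 := mul_le_mul_of_nonneg_right h3 (sq_nonneg (u x))
    simp only
    linarith
  have h5 := mul_le_mul_of_nonneg_left (integral_sq_le_lpNorm_sq hn hu.continuous) (abs_nonneg B)
  rw [Q, neg_le, ← neg_div]
  refine div_le_of_le_mul₀ (sq_nonneg _) (by positivity) ?_
  linarith

theorem bddBelow_QValues (hn : 2 < n) (J : CompatibleACS n M) : BddBelow J.QValues := by
  obtain ⟨C, hC⟩ := J.exists_le_Q hn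
  refine ⟨C, ?_⟩
  rintro _ ⟨u, hu, -, rfl⟩
  exact hC u hu

/-- Real `sInf` defaults to 0 on empty or unbounded-below sets; this certifies that `Y` is the true
infimum. -/
theorem isGLB_QValues (hn : 2 < n) (J : CompatibleACS n M) : IsGLB J.QValues J.Y :=
  isGLB_csInf J.nonempty_QValues (J.bddBelow_QValues hn)

variable (n M) in
theorem exists_lipschitzWith_Y (hn : 2 < n) :
    ∃ L, LipschitzWith L (fun J : CompatibleACS n M ↦ J.Y) := by
  obtain ⟨L, hL0, hL⟩ := exists_abs_Q_sub_le (M := M) hn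
  -- The one-sided bound `Y J ≤ Y J' + L d(J,J')` suffices, by symmetry in `J` and `J'`.
  refine ⟨L.toNNReal, LipschitzWith.of_le_add_mul _ fun J J' ↦ ?_⟩
  rw [← sub_le_iff_le_add]
  refine le_csInf J'.nonempty_QValues ?_
  rintro _ ⟨u, hu, hpos, rfl⟩
  have h1 : J.Y ≤ J.Q u := csInf_le (J.bddBelow_QValues hn) ⟨u, hu, hpos, rfl⟩
  have h2 := (abs_le.1 (hL J J' u hu)).2
  rw [Real.coe_toNNReal _ hL0]
  linarith

end CompatibleACS

end HolomorphicYamabe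

end

theorem mainTheorem10 (n : ℕ) (hn : 6 ≤ n)
    (M : Type*) [TopologicalSpace M] [ChartedSpace (EuclideanSpace ℝ (Fin n)) M]
    [IsManifold (𝓡 n) ∞ M] [T2Space M] [CompactSpace M] [ConnectedSpace M]
    [MeasurableSpace M] [BorelSpace M]
    [RiemannianBundle (fun x : M ↦ TangentSpace (𝓡 n) x)]
    [IsContMDiffRiemannianBundle (𝓡 n) ∞ (EuclideanSpace ℝ (Fin n))
      (fun x : M ↦ TangentSpace (𝓡 n) x)] :
    (∀ J : HolomorphicYamabe.CompatibleACS n M, IsGLB J.QValues J.Y) ∧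
      Continuous (fun J : HolomorphicYamabe.CompatibleACS n M ↦ J.Y) := by
  have hn2 : 2 < n := by omega
  obtain ⟨L, hL⟩ := HolomorphicYamabe.CompatibleACS.exists_lipschitzWith_Y n M hn2
  exact ⟨fun J ↦ J.isGLB_QValues hn2, hL.continuous⟩
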